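/- Put $a=\frac{1+\sqrt5}{2}$, $\bar a=\frac{1-\sqrt5}{2}$, and work in the polynomial ring $\mathbb R[u_1,u_2,u_3,u_4]$. Let $\epsilon_1,\epsilon_2,\epsilon_3$ be the elementary symmetric polynomials of $u_1^2,u_2^2,u_3^2$, let $\delta=(u_1^2-u_2^2)(u_1^2-u_3^2)(u_2^2-u_3^2)$, and put $$h_2=\epsilon_1,\quad h_6=-11\epsilon_3+\epsilon_1\epsilon_2+\sqrt5\,\delta,\quad h_{10}=95\epsilon_2\epsilon_3-32\epsilon_1^2\epsilon_3-5\epsilon_1\epsilon_2^2+2\epsilon_1^3\epsilon_2+3\sqrt5\,\epsilon_2\delta .$$ Let $Z_2,Z_{12},Z_{20},Z_{30}$ be the following basic invariants, of degrees $2,12,20,30$, of the reflection group of type $H_4$ (where $t=u_4$): $$Z_2=h_2+t^2,$$ $$Z_{12}=-h_{10}h_2+\tfrac32h_6^2+(11h_{10}-2h_2^5)t^2+(6h_2^4-33h_2h_6)t^4-(14h_2^3-33h_6)t^6+6h_2^2t^8-2h_2t^{10},$$ $$\begin{aligned}Z_{20}={}&\tfrac12(2h_{10}^2-3h_2h_6^3)+\tfrac12(8h_{10}h_2^4-42h_2^3h_6^2+57h_6^3)t^2\\&-2(38h_{10}h_2^3-2h_2^8+57h_{10}h_6-15h_2^5h_6-84h_2^2h_6^2)t^4\\&+2h_2(148h_{10}h_2-10h_2^6-69h_2^3h_6-153h_6^2)t^6-2(232h_{10}h_2-22h_2^6-201h_2^3h_6-147h_6^2)t^8\\&+2(90h_{10}-22h_2^5-201h_2^2h_6)t^{10}+2h_2(22h_2^3+69h_6)t^{12}-10(2h_2^3+3h_6)t^{14}+4h_2^2t^{16},\end{aligned}$$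 $$\begin{aligned}Z_{30}={}&\tfrac1{15}(20h_{10}^3-45h_{10}h_2h_6^3+27h_6^5)\\ &+(8h_{10}^2h_2^4-42h_{10}h_2^3h_6^2-87h_{10}h_6^3-6h_2^5h_6^3+135h_2^2h_6^4)t^2\\ &+(-152h_{10}^2h_2^3+16h_{10}h_2^8+348h_{10}^2h_6+60h_{10}h_2^5h_6+408h_{10}h_2^2h_6^2-84h_2^7h_6^2+84h_2^4h_6^3-909h_2h_6^4)t^4\\ &+\tfrac23(1752h_{10}^2h_2^2-516h_{10}h_2^7+16h_2^{12}-3258h_{10}h_2^4h_6+180h_2^9h_6-2862h_{10}h_2h_6^2+1998h_2^6h_6^2+432h_2^3h_6^3+3591h_6^4)t^6\\ &-2(1616h_{10}^2h_2-1072h_{10}h_2^6+40h_2^{11}-5454h_{10}h_2^3h_6+336h_2^8h_6+453h_{10}h_6^2+3462h_2^5h_6^2+978h_2^2h_6^3)t^8\\ &+\tfrac25(8100h_{10}^2-17900h_{10}h_2^5+672h_2^{10}-63330h_{10}h_2^2h_6+4020h_2^7h_6+49920h_2^4h_6^2+18375h_2h_6^3)t^{10}\\ &+\tfrac43(10662h_{10}h_2^4-332h_2^9+17631h_{10}h_2h_6-936h_2^6h_6-20547h_2^3h_6^2-4347h_6^3)t^{12}\\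 &-4(4214h_{10}h_2^3-68h_2^8+1905h_{10}h_6-4647h_2^2h_6^2)t^{14}\\ &+4h_2(2506h_{10}h_2+68h_2^6+312h_2^3h_6-1407h_6^2)t^{16}-\tfrac83(1080h_{10}h_2+166h_2^6+603h_2^3h_6-405h_6^2)t^{18}\\ &+\tfrac{24}5(75h_{10}+56h_2^5+140h_2^2h_6)t^{20}-40h_2(2h_2^3+3h_6)t^{22}+\tfrac{32}3h_2^3t^{24}.\end{aligned}$$ A star denotes the replacement of $\sqrt5$ by $-\sqrt5$ in the coefficients. Let $f=\frac1{168}u_4(-21h_6+14h_2^2u_4^2-14h_2u_4^4+2u_4^6)$ and $$P_1=f(u_4,u_3,u_2,u_1),\quad P_2=f(u_3,u_4,u_1,u_2),\quad P_3=f(u_2,u_1,u_4,u_3),\quad P_4=f(u_1,u_2,u_3,u_4),$$ and put $Y_j=Z_j^*(P_1,P_2,P_3,P_4)$ for $j=2,12,20,30$. Let $\mathcal R$ be the set of the $60$ linear forms defining the reflections of the group, in the following normalization: the forms $u_1,u_2,u_3,u_4$; the eight forms $u_1\pm u_2\pm u_3\pm u_4$; and the $48$ forms $u_i+\varepsilon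 a u_j+\varepsilon'\bar a u_k$ with $\varepsilon,\varepsilon'\in\{1,-1\}$ and $$(i,j,k)\in\{(1,3,4),(1,4,2),(1,2,3),(2,3,1),(2,1,4),(2,4,3),(3,1,2),(3,2,4),(3,4,1),(4,2,1),(4,1,3),(4,3,2)\}.$$ Then there are unique polynomials $\hat Y_2,\hat Y_{12},\hat Y_{20},\hat Y_{30}$ in four variables with $Y_j=\hat Y_j(Z_2,Z_{12},Z_{20},Z_{30})$ for $j=2,12,20,30$, and for every $\varphi\in\mathcal R$ there is a unique polynomial $G_{\varphi^*}\in\mathbb R[u_1,u_2,u_3,u_4]$ with $\varphi^*(P_1,P_2,P_3,P_4)=\varphi\cdot G_{\varphi^*}$; it is homogeneous of degree $6$. Writing $\partial(Y_2,Y_{12},Y_{20},Y_{30})/\partial(Z_2,Z_{12},Z_{20},Z_{30})$ for the Jacobian matrix of $(\hat Y_2,\hat Y_{12},\hat Y_{20},\hat Y_{30})$ evaluated at $(Z_2,Z_{12},Z_{20},Z_{30})$, one has in $\mathbb R[u_1,u_2,u_3,u_4]$ $$\det\frac{\partial(Y_2,Y_{12},Y_{20},Y_{30})}{\partial(Z_2,Z_{12},Z_{20},Z_{30})}=c'\,(Z_2^2Z_{20}-Z_{12}^2)\prod_{\varphi\in\mathcal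 R}G_{\varphi^*},\qquad c'=\frac1{2^{10}\cdot3^2}.$$ -/

import Mathlib

open MvPolynomial

noncomputable section

namespace H4

/-- Real polynomials in the coordinates `u₁, u₂, u₃, u₄`, written `X 0, X 1, X 2, X 3`. -/
abbrev Poly : Type := MvPolynomial (Fin 4) ℝ

/-! Below, `s` is a square root of `5`: the value `s = √5` gives the objects attached to `W(H₄)`,
and `s = -√5` gives their conjugates (marked by a star in the usual notation). -/

/-- The elementary symmetric polynomials of `u₁², u₂², u₃²`. -/
def eps1 : Poly := X 0 ^ 2 + X 1 ^ 2 + X 2 ^ 2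

/-- See `eps1`. -/
def eps2 : Poly := X 0 ^ 2 * X 1 ^ 2 + X 0 ^ 2 * X 2 ^ 2 + X 1 ^ 2 * X 2 ^ 2

/-- See `eps1`. -/
def eps3 : Poly := X 0 ^ 2 * X 1 ^ 2 * X 2 ^ 2

/-- The difference product of `u₁², u₂², u₃²`. -/
def delta : Poly := (X 0 ^ 2 - X 1 ^ 2) * (X 0 ^ 2 - X 2 ^ 2) * (X 1 ^ 2 - X 2 ^ 2)

/-- The basic invariant of degree 2 of `W(H₃)`. -/
def h2 : Poly := eps1

/-- The basic invariant of degree 6 of `W(H₃)`. -/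
def h6 (s : ℝ) : Poly := -11 * eps3 + eps1 * eps2 + C s * delta

/-- The basic invariant of degree 10 of `W(H₃)`. -/
def h10 (s : ℝ) : Poly :=
  95 * eps2 * eps3 - 32 * eps1 ^ 2 * eps3 - 5 * eps1 * eps2 ^ 2 + 2 * eps1 ^ 3 * eps2
    + 3 * C s * eps2 * delta

/-- The basic invariant of degree 2 of `W(H₄)`. -/
def Z2 : Poly := h2 + X 3 ^ 2

/-- The expression for the invariant of degree 12 of `W(H₄)` in `h₂, h₆, h₁₀` and `t = u₄`. -/
def Z12Form (p2 p6 p10 t : Poly) : Poly :=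
  -p10 * p2
    + C (3 / 2) * p6 ^ 2
    + (11 * p10 - 2 * p2 ^ 5) * t ^ 2
    + (6 * p2 ^ 4 - 33 * p2 * p6) * t ^ 4
    - (14 * p2 ^ 3 - 33 * p6) * t ^ 6
    + 6 * p2 ^ 2 * t ^ 8
    - 2 * p2 * t ^ 10

/-- The basic invariant of degree 12 of `W(H₄)`. -/
def Z12 (s : ℝ) : Poly := Z12Form h2 (h6 s) (h10 s) (X 3)

/-- The expression for the invariant of degree 20 of `W(H₄)` in `h₂, h₆, h₁₀` and `t = u₄`. -/
def Z20Form (p2 p6 p10 t : Poly) : Poly :=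
  C (1 / 2) * (2 * p10 ^ 2 - 3 * p2 * p6 ^ 3)
    + C (1 / 2) * (8 * p10 * p2 ^ 4 - 42 * p2 ^ 3 * p6 ^ 2 + 57 * p6 ^ 3) * t ^ 2
    - 2 * (38 * p10 * p2 ^ 3 - 2 * p2 ^ 8 + 57 * p10 * p6 - 15 * p2 ^ 5 * p6 - 84 * p2 ^ 2 *
      p6 ^ 2) * t ^ 4
    + 2 * p2 * (148 * p10 * p2 - 10 * p2 ^ 6 - 69 * p2 ^ 3 * p6 - 153 * p6 ^ 2) * t ^ 6
    - 2 * (232 * p10 * p2 - 22 * p2 ^ 6 - 201 * p2 ^ 3 * p6 - 147 * p6 ^ 2) * t ^ 8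
    + 2 * (90 * p10 - 22 * p2 ^ 5 - 201 * p2 ^ 2 * p6) * t ^ 10
    + 2 * p2 * (22 * p2 ^ 3 + 69 * p6) * t ^ 12
    - 10 * (2 * p2 ^ 3 + 3 * p6) * t ^ 14
    + 4 * p2 ^ 2 * t ^ 16

/-- The basic invariant of degree 20 of `W(H₄)`. -/
def Z20 (s : ℝ) : Poly := Z20Form h2 (h6 s) (h10 s) (X 3)

/-- The expression for the invariant of degree 30 of `W(H₄)` in `h₂, h₆, h₁₀` and `t = u₄`. -/
def Z30Form (p2 p6 p10 t : Poly) : Poly :=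
  C (1 / 15) * (20 * p10 ^ 3 - 45 * p10 * p2 * p6 ^ 3 + 27 * p6 ^ 5)
    + (8 * p10 ^ 2 * p2 ^ 4 - 42 * p10 * p2 ^ 3 * p6 ^ 2 - 87 * p10 * p6 ^ 3 - 6 * p2 ^ 5 *
      p6 ^ 3 + 135 * p2 ^ 2 * p6 ^ 4) * t ^ 2
    + (-152 * p10 ^ 2 * p2 ^ 3 + 16 * p10 * p2 ^ 8 + 348 * p10 ^ 2 * p6 + 60 * p10 * p2 ^ 5
      * p6 + 408 * p10 * p2 ^ 2 * p6 ^ 2 - 84 * p2 ^ 7 * p6 ^ 2 + 84 * p2 ^ 4 * p6 ^ 3 - 909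
      * p2 * p6 ^ 4) * t ^ 4
    + C (2 / 3) * (1752 * p10 ^ 2 * p2 ^ 2 - 516 * p10 * p2 ^ 7 + 16 * p2 ^ 12 - 3258 * p10
      * p2 ^ 4 * p6 + 180 * p2 ^ 9 * p6 - 2862 * p10 * p2 * p6 ^ 2 + 1998 * p2 ^ 6 * p6 ^ 2
      + 432 * p2 ^ 3 * p6 ^ 3 + 3591 * p6 ^ 4) * t ^ 6
    - 2 * (1616 * p10 ^ 2 * p2 - 1072 * p10 * p2 ^ 6 + 40 * p2 ^ 11 - 5454 * p10 * p2 ^ 3 *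
      p6 + 336 * p2 ^ 8 * p6 + 453 * p10 * p6 ^ 2 + 3462 * p2 ^ 5 * p6 ^ 2 + 978 * p2 ^ 2 *
      p6 ^ 3) * t ^ 8
    + C (2 / 5) * (8100 * p10 ^ 2 - 17900 * p10 * p2 ^ 5 + 672 * p2 ^ 10 - 63330 * p10 * p2
      ^ 2 * p6 + 4020 * p2 ^ 7 * p6 + 49920 * p2 ^ 4 * p6 ^ 2 + 18375 * p2 * p6 ^ 3) * t ^
      10
    + C (4 / 3) * (10662 * p10 * p2 ^ 4 - 332 * p2 ^ 9 + 17631 * p10 * p2 * p6 - 936 * p2 ^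
      6 * p6 - 20547 * p2 ^ 3 * p6 ^ 2 - 4347 * p6 ^ 3) * t ^ 12
    - 4 * (4214 * p10 * p2 ^ 3 - 68 * p2 ^ 8 + 1905 * p10 * p6 - 4647 * p2 ^ 2 * p6 ^ 2) * t
      ^ 14
    + 4 * p2 * (2506 * p10 * p2 + 68 * p2 ^ 6 + 312 * p2 ^ 3 * p6 - 1407 * p6 ^ 2) * t ^ 16
    - C (8 / 3) * (1080 * p10 * p2 + 166 * p2 ^ 6 + 603 * p2 ^ 3 * p6 - 405 * p6 ^ 2) * t ^
      18
    + C (24 / 5) * (75 * p10 + 56 * p2 ^ 5 + 140 * p2 ^ 2 * p6) * t ^ 20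
    - 40 * p2 * (2 * p2 ^ 3 + 3 * p6) * t ^ 22
    + C (32 / 3) * p2 ^ 3 * t ^ 24

/-- The basic invariant of degree 30 of `W(H₄)`. -/
def Z30 (s : ℝ) : Poly := Z30Form h2 (h6 s) (h10 s) (X 3)

/-- The four basic invariants `(Z₂, Z₁₂, Z₂₀, Z₃₀)`. -/
def Z (s : ℝ) : Fin 4 → Poly := ![Z2, Z12 s, Z20 s, Z30 s]

/-- The form of degree 7 from which `P₁, …, P₄` are obtained by permuting the variables. -/
def f : Poly :=
  C (1 / 168) * X 3 *
    (-21 * h6 √5 + 14 * h2 ^ 2 * X 3 ^ 2 - 14 * h2 * X 3 ^ 4 + 2 * X 3 ^ 6)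

/-- `P₁ = f(u₄,u₃,u₂,u₁)`, `P₂ = f(u₃,u₄,u₁,u₂)`, `P₃ = f(u₂,u₁,u₄,u₃)`, `P₄ = f`. -/
def P : Fin 4 → Poly :=
  ![bind₁ ![X 3, X 2, X 1, X 0] f,
    bind₁ ![X 2, X 3, X 0, X 1] f,
    bind₁ ![X 1, X 0, X 3, X 2] f,
    f]

/-- `Y_j = Z_j^*(P₁, P₂, P₃, P₄)` for `j = 2, 12, 20, 30`. -/
def Y (j : Fin 4) : Poly := bind₁ P (Z (-√5) j)

/-- Coefficient vectors of the 60 linear forms that define the reflections of `W(H₄)`, where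
`a = (1 + √5) / 2` and `b = (1 - √5) / 2`. -/
def rootCoeff (a b : ℝ) : Fin 60 → Fin 4 → ℝ :=
  ![![1, 0, 0, 0], ![0, 1, 0, 0], ![0, 0, 1, 0], ![0, 0, 0, 1],
    ![1, 1, 1, 1], ![1, -1, 1, 1], ![1, 1, -1, 1], ![1, 1, 1, -1],
    ![1, -1, -1, 1], ![1, -1, 1, -1], ![1, 1, -1, -1], ![1, -1, -1, -1],
    ![1, 0, -a, b], ![1, 0, a, -b], ![1, 0, -a, -b], ![1, 0, a, b],
    ![1, b, 0, -a], ![1, -b, 0, a], ![1, -b, 0, -a], ![1, b, 0, a],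
    ![1, -a, b, 0], ![1, a, -b, 0], ![1, -a, -b, 0], ![1, a, b, 0],
    ![b, 1, -a, 0], ![-b, 1, -a, 0], ![-b, 1, a, 0], ![b, 1, a, 0],
    ![-a, 1, 0, b], ![a, 1, 0, -b], ![-a, 1, 0, -b], ![a, 1, 0, b],
    ![0, 1, b, -a], ![0, 1, -b, a], ![0, 1, -b, -a], ![0, 1, b, a],
    ![-a, b, 1, 0], ![-a, -b, 1, 0], ![a, -b, 1, 0], ![a, b, 1, 0],
    ![0, -a, 1, b], ![0, a, 1, -b], ![0, -a, 1, -b], ![0, a, 1, b],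
    ![b, 0, 1, -a], ![-b, 0, 1, -a], ![-b, 0, 1, a], ![b, 0, 1, a],
    ![b, -a, 0, 1], ![-b, -a, 0, 1], ![-b, a, 0, 1], ![b, a, 0, 1],
    ![-a, 0, b, 1], ![-a, 0, -b, 1], ![a, 0, -b, 1], ![a, 0, b, 1],
    ![0, b, -a, 1], ![0, -b, -a, 1], ![0, -b, a, 1], ![0, b, a, 1]]

/-- The `k`-th linear form `φ_k` (for `s = √5`), and its conjugate `φ_k^*` (for `s = -√5`). -/
def rootForm (s : ℝ) (k : Fin 60) : Poly :=
  ∑ i, C (rootCoeff ((1 + s) / 2) ((1 - s) / 2) k i) * X i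

/-- The Jacobian matrix of four polynomials in four variables. -/
def jacobianMatrix (F : Fin 4 → Poly) : Matrix (Fin 4) (Fin 4) Poly :=
  Matrix.of fun i j => pderiv i (F j)

/-- `IsExpr Yhat`: the polynomials `Yhat j` express the `Y_j` through the basic invariants,
`Y_j = Yhat_j(Z₂, Z₁₂, Z₂₀, Z₃₀)`. -/
def IsExpr (Yhat : Fin 4 → Poly) : Prop := ∀ j, bind₁ (Z √5) (Yhat j) = Y j

/-- `IsQuot G`: for every `k`, `G k` is the quotient `φ_k^*(P₁, P₂, P₃, P₄) / φ_k`. -/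
def IsQuot (G : Fin 60 → Poly) : Prop :=
  ∀ k, G k * rootForm √5 k = bind₁ P (rootForm (-√5) k)

end H4

end

/-! Write `Z` for the invariants, `Z*` for their conjugates and J for Jacobian determinants. The
substitution `P` intertwines the reflection in each form φ with the reflection in φ*. Hence every `Y
j` is invariant under the 60 reflections, and φ*(P) is negated by the reflection in φ, so φ divides
it.

The degrees 2, 12, 20, 30 satisfy 1 + 11 + 19 + 29 = 60, so J(Z) is a constant times ∏ φ
(`det_jacobianMatrix_Z`). The constant is nonzero, so the `Z` are algebraically independent and
generate the invariants (`exists_bind₁_eq_of_invariant`).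

The chain rule applied to Ŷ(Z) = Z*(P) gives J(Z) · (det ∂Y/∂Z) = J(P) · J(Z*)(P). The constants of
J(Z) and J(Z*) are opposite, being multiples of √5 and -√5, so det ∂Y/∂Z = -J(P) · ∏ G. Finally J(P)
is an invariant of degree 24, hence a combination of four monomials in the `Z`; its restriction to
the plane u₁ = u₂ = 0 determines it (`det_jacobianMatrix_P`).

The symmetry behind this (`isSymRoot_root`) needs a direct computation for only one reflection.
Signed even permutations and conjugation supply the others. Gradient pairings reduce the invariance
of the higher invariants to that of the lower ones. -/

noncomputable section

namespace MvPolynomial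

/-! ### Chain rule, gradient pairing and homogeneity -/

section General

variable {σ τ R : Type*} [CommRing R]

/-- The chain rule for substitutions of polynomials. -/
theorem pderiv_bind₁ [Fintype σ] (g : σ → MvPolynomial τ R) (F : MvPolynomial σ R) (i : τ) :
    pderiv i (bind₁ g F) = ∑ l, pderiv i (g l) * bind₁ g (pderiv l F) := by
  classical
  induction F using MvPolynomial.induction_on with
  | C a => simp
  | add p q hp hq => simp only [map_add, hp, hq, mul_add, Finset.sum_add_distrib]
  | mul_X p j hp =>
    simp only [map_mul, pderiv_mul, hp, bind₁_X_right, map_add, pderiv_X, mul_add,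
      Finset.sum_add_distrib, Finset.sum_mul]
    congr 1
    · exact Finset.sum_congr rfl fun l _ => by ring
    · rw [Finset.sum_eq_single j]
      · simp [mul_comm]
      · intro b _ hb
        simp [hb]
      · simp

/-- The pairing of gradients. -/
def gram [Fintype σ] (F G : MvPolynomial σ R) : MvPolynomial σ R := ∑ i, pderiv i F * pderiv i G

theorem gram_comm [Fintype σ] (F G : MvPolynomial σ R) : gram F G = gram G F :=
  Finset.sum_congr rfl fun _ _ => mul_comm _ _

/-- The chain rule for the pairing of gradients. -/
theorem gram_bind₁ [Fintype σ] [Fintype τ] (g : σ → MvPolynomial τ R) (F G : MvPolynomial σ R) :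
    gram (bind₁ g F) (bind₁ g G) =
      ∑ a, ∑ b, bind₁ g (pderiv a F) * bind₁ g (pderiv b G) * gram (g a) (g b) := by
  simp only [gram, pderiv_bind₁, Finset.sum_mul_sum]
  rw [Finset.sum_comm]
  refine Finset.sum_congr rfl fun a _ => ?_
  rw [Finset.sum_comm]
  refine Finset.sum_congr rfl fun b _ => ?_
  rw [Finset.mul_sum]
  exact Finset.sum_congr rfl fun i _ => by ring

/-- Orthogonal substitutions preserve the pairing of gradients. -/
theorem gram_bind₁_of_orthogonal [Fintype σ] [DecidableEq σ] {g : σ → MvPolynomial σ R}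
    (hg : ∀ i j, gram (g i) (g j) = if i = j then 1 else 0) (F G : MvPolynomial σ R) :
    gram (bind₁ g F) (bind₁ g G) = bind₁ g (gram F G) := by
  rw [gram_bind₁]
  simp only [hg, mul_ite, mul_one, mul_zero, Finset.sum_ite_eq, Finset.mem_univ, if_true]
  simp [gram]

theorem eval_bind₁ (g : σ → MvPolynomial τ R) (F : MvPolynomial σ R) (x : τ → R) :
    eval x (bind₁ g F) = eval (fun i => eval x (g i)) F := by
  induction F using MvPolynomial.induction_on with
  | C a => simp
  | add p q hp hq => simp only [map_add, hp, hq]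
  | mul_X p i hp => simp only [map_mul, hp, bind₁_X_right, eval_X]

theorem coeff_bind₁_C_mul_X (a : R) (F : MvPolynomial σ R) (m : σ →₀ ℕ) :
    coeff m (bind₁ (fun i => C a * X i) F) = a ^ m.degree * coeff m F := by
  classical
  induction F using MvPolynomial.induction_on' with
  | add p q hp hq => simp only [map_add, coeff_add, hp, hq, mul_add]
  | monomial u c =>
    have h : bind₁ (fun i => C a * X i) (monomial u c) = monomial u (a ^ u.degree * c) := by
      rw [bind₁_monomial, monomial_eq, Finsupp.prod]
      simp only [mul_pow, Finset.prod_mul_distrib, ← C_pow, ← map_prod, Finset.prod_pow_eq_pow_sum,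
        Finsupp.degree_apply, C_mul]
      ring
    rw [h, coeff_monomial, coeff_monomial]
    split_ifs with h1
    · rw [h1]
    · simp

/-- A polynomial that scales like a homogeneous one is homogeneous. -/
theorem isHomogeneous_of_bind₁_two [IsDomain R] [CharZero R] {F : MvPolynomial σ R} {n : ℕ}
    (h : bind₁ (fun i => C 2 * X i) F = C (2 ^ n) * F) : F.IsHomogeneous n := by
  rw [IsHomogeneous, IsWeightedHomogeneous]
  intro m hm
  have h1 := congrArg (coeff m) h
  rw [coeff_bind₁_C_mul_X, coeff_C_mul] at h1
  have h2 := mul_right_cancel₀ hm h1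
  -- Powers of 2 are distinct in characteristic zero, so this single scaling already separates the
  -- degrees.
  have h3 : (2 : ℕ) ^ m.degree = 2 ^ n := by exact_mod_cast h2
  rw [← Nat.pow_right_injective le_rfl h3, Finsupp.degree_eq_weight_one]
  rfl

/-- Linear substitutions respect the grading; thus the homogeneous components of an invariant of
reflections are invariant. -/
theorem homogeneousComponent_bind₁ {g : σ → MvPolynomial τ R} (hg : ∀ i, (g i).IsHomogeneous 1)
    (F : MvPolynomial σ R) (n : ℕ) :
    homogeneousComponent n (bind₁ g F) = bind₁ g (homogeneousComponent n F) := by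
  have key : ∀ m, (bind₁ g (homogeneousComponent m F)).IsHomogeneous m := by
    intro m
    have := (homogeneousComponent_isHomogeneous m F).aeval g hg
    rwa [one_mul] at this
  conv_lhs => rw [← sum_homogeneousComponent F]
  rw [map_sum, map_sum]
  by_cases hn : n ∈ Finset.range (F.totalDegree + 1)
  · rw [Finset.sum_eq_single n]
    · exact homogeneousComponent_eq_self (key n)
    · intro m _ hm
      rw [homogeneousComponent_of_mem (key m), if_neg (Ne.symm hm)]
    · exact fun h => absurd hn h
  · rw [homogeneousComponent_eq_zero n F (by simpa using hn), map_zero]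
    refine Finset.sum_eq_zero fun m hm => ?_
    rw [homogeneousComponent_of_mem (key m), if_neg]
    rintro rfl
    exact hn hm

theorem homogeneousComponent_mul_of_isHomogeneous {Z : MvPolynomial σ R} {d : ℕ}
    (hZ : Z.IsHomogeneous d) (F : MvPolynomial σ R) (n : ℕ) :
    homogeneousComponent n (Z * F) =
      if d ≤ n then Z * homogeneousComponent (n - d) F else 0 := by
  have key : ∀ m, (Z * homogeneousComponent m F).IsHomogeneous (d + m) := fun m =>
    hZ.mul (homogeneousComponent_isHomogeneous m F)
  conv_lhs => rw [← sum_homogeneousComponent F]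
  rw [Finset.mul_sum, map_sum]
  split_ifs with hd
  · by_cases hn : n - d ∈ Finset.range (F.totalDegree + 1)
    · rw [Finset.sum_eq_single (n - d)]
      · rw [homogeneousComponent_of_mem (key _), if_pos (by omega)]
      · intro m _ hm
        rw [homogeneousComponent_of_mem (key m), if_neg (by omega)]
      · exact fun h => absurd hn h
    · rw [homogeneousComponent_eq_zero _ F (by simp at hn; omega), mul_zero]
      refine Finset.sum_eq_zero fun m hm => ?_
      rw [homogeneousComponent_of_mem (key m), if_neg]
      intro h
      apply hn
      rwa [show n - d = m by omega]
  · refine Finset.sum_eq_zero fun m hm => ?_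
    rw [homogeneousComponent_of_mem (key m), if_neg (by omega)]

/-- A nonzero homogeneous factor of a homogeneous polynomial has a homogeneous cofactor. -/
theorem IsHomogeneous.of_mul_left [IsDomain R] {Z F : MvPolynomial σ R} {d n : ℕ} (hZ : Z.IsHomogeneous d)
    (hZ0 : Z ≠ 0) (h : (Z * F).IsHomogeneous (d + n)) : F.IsHomogeneous n := by
  have h1 := homogeneousComponent_mul_of_isHomogeneous hZ F (d + n)
  rw [if_pos (by omega), homogeneousComponent_eq_self h, Nat.add_sub_cancel_left] at h1
  rw [mul_left_cancel₀ hZ0 h1]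
  exact homogeneousComponent_isHomogeneous _ _

theorem eq_C_of_pderiv_eq_zero [IsDomain R] [CharZero R] {F : MvPolynomial σ R} (h : ∀ i, pderiv i F = 0) :
    F = C (coeff 0 F) := by
  classical
  ext m
  rw [coeff_C]
  split_ifs with hm
  · rw [← hm]
  · obtain ⟨i, hi⟩ : ∃ i, m i ≠ 0 := by
      by_contra hcon
      push Not at hcon
      exact hm (Finsupp.ext fun i => (hcon i).symm)
    have h1 := coeff_pderiv (i := i) F (m - Finsupp.single i 1)
    rw [h i, coeff_zero] at h1
    have h2 : m - Finsupp.single i 1 + Finsupp.single i 1 = m := by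
      ext j
      by_cases hj : j = i
      · subst hj
        simp
        omega
      · simp [Ne.symm hj]
    rw [h2] at h1
    rcases mul_eq_zero.1 h1.symm with h3 | h3
    · exact h3
    · exact absurd h3 (Nat.cast_add_one_ne_zero _)

/-- This drives the descent on the degree of an algebraic relation. -/
theorem totalDegree_pderiv_lt {F : MvPolynomial σ R} {i : σ} (h : pderiv i F ≠ 0) :
    (pderiv i F).totalDegree < F.totalDegree := by
  classical
  have h1 : ∀ m ∈ (pderiv i F).support, m.degree + 1 ≤ F.totalDegree := by
    intro m hm
    have h2 : coeff (m + Finsupp.single i 1) F ≠ 0 := by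
      intro h0
      rw [mem_support_iff, coeff_pderiv, h0, zero_mul] at hm
      exact hm rfl
    have := le_totalDegree (mem_support_iff.2 h2)
    change (m + Finsupp.single i 1).degree ≤ _ at this
    simpa using this
  obtain ⟨m, hm⟩ := support_nonempty.2 h
  have h0 := h1 m hm
  refine (Finset.sup_lt_iff (by rw [bot_eq_zero]; omega)).2 fun m hm => ?_
  have := h1 m hm
  change m.degree < _
  omega

end General

/-! ### Linear forms and reflections -/

section Reflections

variable {σ K : Type*} [Field K] [Fintype σ]

/-- The linear form with coefficient vector `v`. -/
def linForm (v : σ → K) : MvPolynomial σ K := ∑ i, C (v i) * X i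

theorem coeff_linForm (v : σ → K) (i : σ) : coeff (Finsupp.single i 1) (linForm v) = v i := by
  classical
  simp only [linForm, coeff_sum, coeff_C_mul, coeff_X]
  rw [Finset.sum_eq_single i]
  · simp
  · intro b _ hb
    rw [if_neg, mul_zero]
    intro h
    exact hb (Finsupp.single_left_injective one_ne_zero h)
  · simp

theorem linForm_isHomogeneous (v : σ → K) : (linForm v).IsHomogeneous 1 :=
  IsHomogeneous.sum _ _ _ fun i _ => isHomogeneous_C_mul_X _ i

theorem linForm_ne_zero {v : σ → K} (hv : v ≠ 0) : linForm v ≠ 0 := by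
  intro h
  apply hv
  ext i
  rw [← coeff_linForm v i, h, coeff_zero, Pi.zero_apply]

theorem irreducible_linForm {v : σ → K} (hv : v ≠ 0) : Irreducible (linForm v) := by
  obtain ⟨i, hi⟩ := Function.ne_iff.1 hv
  refine irreducible_of_totalDegree_eq_one
    ((linForm_isHomogeneous v).totalDegree (linForm_ne_zero hv)) fun x hx => ?_
  have h := hx (Finsupp.single i 1)
  rw [coeff_linForm] at h
  exact isUnit_iff_ne_zero.2 fun h0 => hi (by simpa [h0] using h)

/-- Two linear forms without a common scale are coprime. -/
theorem isRelPrime_linForm {v w : σ → K} (hv : v ≠ 0) {i j : σ} (h : v i * w j ≠ v j * w i) :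
    IsRelPrime (linForm v) (linForm w) := by
  refine (irreducible_linForm hv).isRelPrime_iff_not_dvd.2 ?_
  rintro ⟨q, hq⟩
  have hw : w ≠ 0 := by
    rintro rfl
    simp at h
  have hw1 := (linForm_isHomogeneous w).totalDegree (linForm_ne_zero hw)
  have hq0 : q ≠ 0 := by
    rintro rfl
    rw [mul_zero] at hq
    exact linForm_ne_zero hw hq
  rw [hq, totalDegree_mul_of_isDomain (linForm_ne_zero hv) hq0,
    (linForm_isHomogeneous v).totalDegree (linForm_ne_zero hv)] at hw1
  rw [totalDegree_eq_zero_iff_eq_C.1 (show q.totalDegree = 0 by omega)] at hq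
  have hc : ∀ l, w l = v l * coeff 0 q := by
    intro l
    have := congrArg (coeff (Finsupp.single l 1)) hq
    rwa [coeff_linForm, mul_comm, coeff_C_mul, coeff_linForm, mul_comm] at this
  apply h
  rw [hc i, hc j]
  ring

/-- The substitution of the reflection in the hyperplane `v = 0`. -/
def reflSubst (v : σ → K) (i : σ) : MvPolynomial σ K :=
  X i - C (2 * v i / ∑ l, v l * v l) * linForm v

/-- A reflection fixes its mirror pointwise: each variable moves by a multiple of the linear form,
so the substitution is the identity modulo that form. -/
theorem linForm_dvd_bind₁_reflSubst_sub (v : σ → K) (F : MvPolynomial σ K) :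
    linForm v ∣ bind₁ (reflSubst v) F - F := by
  induction F using MvPolynomial.induction_on with
  | C a => simp
  | add p q hp hq =>
    rw [map_add, add_sub_add_comm]
    exact dvd_add hp hq
  | mul_X p i hp =>
    rw [map_mul, bind₁_X_right]
    have : bind₁ (reflSubst v) p * reflSubst v i - p * X i =
        (bind₁ (reflSubst v) p - p) * reflSubst v i +
          linForm v * (-(C (2 * v i / ∑ l, v l * v l)) * p) := by
      rw [reflSubst]
      ring
    rw [this]
    exact dvd_add (hp.mul_right _) (dvd_mul_right _ _)

/-- A polynomial negated by a reflection is divisible by the corresponding linear form. -/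
theorem linForm_dvd_of_bind₁_eq_neg [CharZero K] {v : σ → K} {F : MvPolynomial σ K}
    (h : bind₁ (reflSubst v) F = -F) : linForm v ∣ F := by
  have h1 := linForm_dvd_bind₁_reflSubst_sub v F
  rw [h] at h1
  have h2 : F = (-F - F) * C (-1 / 2) := by
    have : (C (-1 / 2) : MvPolynomial σ K) * 2 = -1 := by
      rw [show (2 : MvPolynomial σ K) = C 2 from (map_ofNat C 2).symm, ← C_mul, ← C_1, ← C_neg]
      norm_num
    linear_combination F * this
  rw [h2]
  exact h1.mul_right _

theorem bind₁_reflSubst_linForm {v : σ → K} (hv : ∑ l, v l * v l ≠ 0) :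
    bind₁ (reflSubst v) (linForm v) = -linForm v := by
  conv_lhs => rw [linForm]
  have hs : bind₁ (reflSubst v) (∑ i, C (v i) * X i) =
      linForm v - C (∑ x, v x * (2 * v x / ∑ l, v l * v l)) * linForm v := by
    rw [map_sum, map_sum, Finset.sum_mul]
    conv_rhs => enter [1]; rw [linForm]
    rw [← Finset.sum_sub_distrib]
    refine Finset.sum_congr rfl fun i _ => ?_
    rw [map_mul, bind₁_C_right, bind₁_X_right, reflSubst, C_mul]
    ring
  rw [hs]
  have : ∑ x, v x * (2 * v x / ∑ l, v l * v l) = 2 := by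
    calc ∑ x, v x * (2 * v x / ∑ l, v l * v l) = 2 * (∑ l, v l * v l) / ∑ l, v l * v l := by
          rw [Finset.mul_sum, Finset.sum_div]
          exact Finset.sum_congr rfl fun x _ => by ring
      _ = 2 := by rw [mul_div_assoc, div_self hv, mul_one]
  rw [this, show (C 2 : MvPolynomial σ K) = 2 from map_ofNat C 2]
  ring

theorem reflSubst_isHomogeneous (v : σ → K) (i : σ) : (reflSubst v i).IsHomogeneous 1 :=
  (isHomogeneous_X _ i).sub ((linForm_isHomogeneous v).C_mul _)

theorem pderiv_linForm [DecidableEq σ] (v : σ → K) (i : σ) : pderiv i (linForm v) = C (v i) := by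
  simp only [linForm, map_sum, pderiv_C_mul, pderiv_X]
  rw [Finset.sum_eq_single i]
  · simp
  · intro b _ hb
    simp [hb]
  · simp

theorem pderiv_reflSubst [DecidableEq σ] (v : σ → K) (i j : σ) :
    pderiv i (reflSubst v j) = C ((1 - Matrix.replicateCol Unit (fun j => 2 * v j / ∑ l, v l * v l) *
      Matrix.replicateRow Unit v : Matrix σ σ K) j i) := by
  simp only [reflSubst, map_sub, pderiv_C_mul, pderiv_linForm, pderiv_X, Matrix.sub_apply,
    Matrix.one_apply, Matrix.mul_apply, Finset.univ_unique, Finset.sum_singleton,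
    Matrix.replicateCol_apply, Matrix.replicateRow_apply, C_mul, Pi.single_apply]
  split_ifs with h <;> simp

/-- The matrix is a rank-one perturbation of the identity, so det(1 - AB) = det(1 - BA) reduces the
determinant to the 1×1 value 1 - 2. -/
theorem det_reflection [DecidableEq σ] {v : σ → K} (hv : ∑ l, v l * v l ≠ 0) :
    (1 - Matrix.replicateCol Unit (fun j => 2 * v j / ∑ l, v l * v l) *
      Matrix.replicateRow Unit v : Matrix σ σ K).det = -1 := by
  rw [Matrix.det_one_sub_mul_comm]
  simp only [Matrix.det_unique, Matrix.sub_apply, Matrix.one_apply_eq, Matrix.mul_apply,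
    Matrix.replicateCol_apply, Matrix.replicateRow_apply]
  have : ∑ x, v x * (2 * v x / ∑ l, v l * v l) = 2 := by
    calc ∑ x, v x * (2 * v x / ∑ l, v l * v l) = 2 * (∑ l, v l * v l) / ∑ l, v l * v l := by
          rw [Finset.mul_sum, Finset.sum_div]
          exact Finset.sum_congr rfl fun x _ => by ring
      _ = 2 := by rw [mul_div_assoc, div_self hv, mul_one]
  rw [this]
  norm_num

end Reflections

end MvPolynomial

namespace H4

/-! ### Jacobians and algebraic independence -/

theorem jacobianMatrix_bind₁ (g F : Fin 4 → Poly) :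
    jacobianMatrix (fun j => bind₁ g (F j)) =
      jacobianMatrix g * (jacobianMatrix F).map (bind₁ g) := by
  ext1 i j
  simp only [jacobianMatrix, Matrix.of_apply, Matrix.mul_apply, Matrix.map_apply, pderiv_bind₁]

theorem det_jacobianMatrix_bind₁ (g F : Fin 4 → Poly) :
    (jacobianMatrix fun j => bind₁ g (F j)).det =
      (jacobianMatrix g).det * bind₁ g (jacobianMatrix F).det := by
  rw [jacobianMatrix_bind₁, Matrix.det_mul, AlgHom.map_det]
  rfl

theorem det_jacobianMatrix_reflSubst {v : Fin 4 → ℝ} (hv : ∑ l, v l * v l ≠ 0) :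
    (jacobianMatrix (reflSubst v)).det = -1 := by
  have : jacobianMatrix (reflSubst v) =
      ((1 - Matrix.replicateCol Unit (fun j => 2 * v j / ∑ l, v l * v l) *
      Matrix.replicateRow Unit v : Matrix (Fin 4) (Fin 4) ℝ).map C).transpose := by
    ext1 i j
    simp only [jacobianMatrix, Matrix.of_apply, pderiv_reflSubst, Matrix.transpose_apply, Matrix.map_apply]
  rw [this, Matrix.det_transpose]
  change ((C : ℝ →+* Poly).mapMatrix _).det = _
  rw [← RingHom.map_det, det_reflection hv, C_neg, C_1]

/-- The Jacobian of four invariants of a reflection is negated by it. -/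
theorem bind₁_det_jacobianMatrix_of_invariant {v : Fin 4 → ℝ} (hv : ∑ l, v l * v l ≠ 0)
    {F : Fin 4 → Poly} (hF : ∀ j, bind₁ (reflSubst v) (F j) = F j) :
    bind₁ (reflSubst v) (jacobianMatrix F).det = -(jacobianMatrix F).det := by
  have h := det_jacobianMatrix_bind₁ (reflSubst v) F
  simp only [hF, det_jacobianMatrix_reflSubst hv] at h
  linear_combination h

/-- Polynomials with a nonzero Jacobian are algebraically independent. -/
theorem eq_zero_of_bind₁_eq_zero {F : Fin 4 → Poly} (hF : (jacobianMatrix F).det ≠ 0) {Q : Poly}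
    (hQ : bind₁ F Q = 0) : Q = 0 := by
  induction hn : Q.totalDegree using Nat.strong_induction_on generalizing Q with
  | _ n ih =>
  -- Differentiating the relation Q(F) = 0 puts the vector of all (∂Q/∂X_l)(F) in the kernel of a
  -- nonsingular matrix. The derivatives of Q are thus relations of smaller degree, zero by
  -- induction, and Q is constant.
  have hv : (jacobianMatrix F).mulVec (fun l => bind₁ F (pderiv l Q)) = 0 := by
    ext1 i
    have := pderiv_bind₁ F Q i
    rw [hQ, map_zero] at this
    exact this.symm
  have hz := Matrix.eq_zero_of_mulVec_eq_zero hF hv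
  have hd : ∀ l, pderiv l Q = 0 := by
    intro l
    by_contra hl
    exact hl (ih _ (hn ▸ totalDegree_pderiv_lt hl) (congrFun hz l) rfl)
  have hc := eq_C_of_pderiv_eq_zero hd
  rw [hc, bind₁_C_right] at hQ
  rw [hc, hQ]

/-! ### Generation of the ring of invariants by the Jacobian criterion -/

section InvariantRing

variable {κ : Type*} [Fintype κ] {v : κ → Fin 4 → ℝ}

/-- A polynomial negated by several reflections is divisible by the product of the linear forms. -/
theorem prod_linForm_dvd (hv : ∀ k, ∑ l, v k l * v k l ≠ 0)
    (hvw : ∀ k l, k ≠ l → ∃ i j, v k i * v l j ≠ v k j * v l i) {F : Poly}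
    (hF : ∀ k, bind₁ (reflSubst (v k)) F = -F) : ∏ k, linForm (v k) ∣ F := by
  refine Fintype.prod_dvd_of_isRelPrime (fun k l hkl => ?_) fun k => linForm_dvd_of_bind₁_eq_neg (hF k)
  obtain ⟨i, j, h⟩ := hvw k l hkl
  refine isRelPrime_linForm ?_ h
  intro h0
  exact hv k (by simp [h0])

theorem totalDegree_det_jacobianMatrix_le {Z : Fin 4 → Poly} {d : Fin 4 → ℕ}
    (hZ : ∀ j, (Z j).IsHomogeneous (d j)) : (jacobianMatrix Z).det.totalDegree ≤ ∑ j, (d j - 1) := by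
  rw [Matrix.det_apply]
  refine totalDegree_finsetSum_le fun p _ => ?_
  refine (totalDegree_smul_le _ _).trans ?_
  refine (totalDegree_finsetProd _ _).trans ?_
  exact Finset.sum_le_sum fun j _ => ((hZ j).pderiv (i := p j)).totalDegree_le

/-- The Jacobian of four invariants is a multiple of the product of the linear forms, and the
factor is a constant for reasons of degree. -/
theorem exists_det_jacobianMatrix_eq (hv : ∀ k, ∑ l, v k l * v k l ≠ 0)
    (hvw : ∀ k l, k ≠ l → ∃ i j, v k i * v l j ≠ v k j * v l i) {Z : Fin 4 → Poly} {d : Fin 4 → ℕ}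
    (hZh : ∀ j, (Z j).IsHomogeneous (d j)) (hZ : ∀ k j, bind₁ (reflSubst (v k)) (Z j) = Z j)
    (hd : ∑ j, (d j - 1) ≤ Fintype.card κ) :
    ∃ c : ℝ, (jacobianMatrix Z).det = C c * ∏ k, linForm (v k) := by
  obtain ⟨q, hq⟩ := prod_linForm_dvd hv hvw
    fun k => bind₁_det_jacobianMatrix_of_invariant (hv k) (hZ k)
  have h0 : ∀ k, linForm (v k) ≠ 0 := fun k => linForm_ne_zero fun h => hv k (by simp [h])
  by_cases hq0 : q = 0
  · exact ⟨0, by rw [hq, hq0, mul_zero, C_0, zero_mul]⟩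
  have hp : (∏ k, linForm (v k)).IsHomogeneous (∑ _k : κ, 1) :=
    IsHomogeneous.prod _ _ _ fun k _ => linForm_isHomogeneous (v k)
  have hp0 : ∏ k, linForm (v k) ≠ 0 := Finset.prod_ne_zero_iff.2 fun k _ => h0 k
  have h1 := totalDegree_det_jacobianMatrix_le hZh
  rw [hq, totalDegree_mul_of_isDomain hp0 hq0, hp.totalDegree hp0, Finset.sum_const,
    Finset.card_univ, smul_eq_mul, mul_one] at h1
  refine ⟨coeff 0 q, ?_⟩
  rw [hq, mul_comm, ← totalDegree_eq_zero_iff_eq_C.1 (show q.totalDegree = 0 by omega)]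

/-- Homogeneous invariants whose Jacobian is the product of the linear forms generate the
invariants of the reflections. -/
theorem exists_bind₁_eq_of_invariant (hv : ∀ k, ∑ l, v k l * v k l ≠ 0)
    (hvw : ∀ k l, k ≠ l → ∃ i j, v k i * v l j ≠ v k j * v l i) {Z : Fin 4 → Poly} {d : Fin 4 → ℕ}
    (hd : ∀ j, 0 < d j)
    (hZh : ∀ j, (Z j).IsHomogeneous (d j)) (hZ : ∀ k j, bind₁ (reflSubst (v k)) (Z j) = Z j)
    {c : ℝ} (hc : c ≠ 0) (hJ : (jacobianMatrix Z).det = C c * ∏ k, linForm (v k))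
    (n : ℕ) (F : Poly) (hFh : F.IsHomogeneous n) (hF : ∀ k, bind₁ (reflSubst (v k)) F = F) :
    ∃ Q : Poly, Q.IsWeightedHomogeneous d n ∧ bind₁ Z Q = F := by
  induction n using Nat.strong_induction_on generalizing F with
  | _ n ih =>
  rcases Nat.eq_zero_or_pos n with rfl | hn
  · refine ⟨C (coeff 0 F), isWeightedHomogeneous_C _ _, ?_⟩
    rw [bind₁_C_right, ← totalDegree_eq_zero_iff_eq_C.1 (Nat.le_zero.1 hFh.totalDegree_le)]
  have hp0 : ∏ k, linForm (v k) ≠ 0 :=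
    Finset.prod_ne_zero_iff.2 fun k _ => linForm_ne_zero fun h => hv k (by simp [h])
  have hpr : ∀ k, bind₁ (reflSubst (v k)) (∏ l, linForm (v l)) = -∏ l, linForm (v l) := by
    intro k
    have h := bind₁_det_jacobianMatrix_of_invariant (hv k) (hZ k)
    rw [hJ, map_mul, bind₁_C_right, ← mul_neg] at h
    exact mul_left_cancel₀ (C_ne_zero.2 hc) h
  have hanti : ∀ j k, bind₁ (reflSubst (v k)) (jacobianMatrix (Function.update Z j F)).det =
      -(jacobianMatrix (Function.update Z j F)).det := by
    intro j k
    refine bind₁_det_jacobianMatrix_of_invariant (hv k) fun l => ?_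
    rcases eq_or_ne l j with rfl | hl
    · rw [Function.update_self, hF]
    · rw [Function.update_of_ne hl, hZ]
  -- Replacing one `Z j` by F leaves an anti-invariant Jacobian, whose quotient `b j` by the product
  -- of the linear forms is invariant. By Cramer's rule the `b j` are, up to `c`, the coefficients
  -- of grad F in the gradients of the `Z j`.
  choose b hb using fun j => prod_linForm_dvd hv hvw (hanti j)
  have hbinv : ∀ j k, bind₁ (reflSubst (v k)) (b j) = b j := by
    intro j k
    have h := hanti j k
    rw [hb, map_mul, hpr, ← neg_mul] at h
    exact mul_left_cancel₀ (neg_ne_zero.2 hp0) h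
  have hcr : (jacobianMatrix Z).cramer (fun i => pderiv i F) =
      fun j => (∏ k, linForm (v k)) * b j := by
    ext1 j
    rw [Matrix.cramer_apply, ← hb]
    congr 1
    ext1 i l
    rcases eq_or_ne l j with rfl | hl
    · simp [jacobianMatrix]
    · simp [jacobianMatrix, hl]
  have hgrad : ∀ i, C c * pderiv i F = ∑ j, pderiv i (Z j) * b j := by
    intro i
    have h := congrFun (Matrix.mulVec_cramer (jacobianMatrix Z) fun i => pderiv i F) i
    rw [hcr, hJ] at h
    apply mul_left_cancel₀ hp0
    rw [Finset.mul_sum]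
    calc (∏ k, linForm (v k)) * (C c * pderiv i F)
        = ((C c * ∏ k, linForm (v k)) • fun i => pderiv i F) i := by
          rw [Pi.smul_apply, smul_eq_mul]
          ring
      _ = _ := by
          rw [← h]
          simp only [Matrix.mulVec, dotProduct, jacobianMatrix, Matrix.of_apply]
          exact Finset.sum_congr rfl fun j _ => by ring
  -- Pairing the gradient identity with the position vector and applying Euler's formula turns it
  -- into an identity for F itself.
  have heuler : C (c * n) * F = ∑ j, C (d j : ℝ) * (Z j * b j) := by
    have h1 : ∀ j, ∑ i, X i * pderiv i (Z j) = C (d j : ℝ) * Z j := fun j => by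
      rw [(hZh j).sum_X_mul_pderiv, nsmul_eq_mul, map_natCast]
    calc C (c * n) * F = C c * ∑ i, X i * pderiv i F := by
          rw [hFh.sum_X_mul_pderiv, nsmul_eq_mul, C_mul, map_natCast, mul_assoc]
      _ = ∑ i, X i * ∑ j, pderiv i (Z j) * b j := by
          rw [Finset.mul_sum]
          exact Finset.sum_congr rfl fun i _ => by rw [← hgrad]; ring
      _ = ∑ j, (∑ i, X i * pderiv i (Z j)) * b j := by
          simp only [Finset.mul_sum, Finset.sum_mul]
          rw [Finset.sum_comm]
          exact Finset.sum_congr rfl fun j _ => Finset.sum_congr rfl fun i _ => by ring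
      _ = _ := Finset.sum_congr rfl fun j _ => by rw [h1, mul_assoc]
  -- The `b j` are not known to be homogeneous, so only the component of degree `n` is kept; it
  -- involves invariants of degree `n - d j`, to which the induction hypothesis applies.
  have hcomp : C (c * n) * F =
      ∑ j, C (d j : ℝ) * if d j ≤ n then Z j * homogeneousComponent (n - d j) (b j) else 0 := by
    have h := congrArg (homogeneousComponent n) heuler
    rw [homogeneousComponent_C_mul, homogeneousComponent_eq_self hFh, map_sum] at h
    rw [h]
    refine Finset.sum_congr rfl fun j _ => ?_
    rw [homogeneousComponent_C_mul, homogeneousComponent_mul_of_isHomogeneous (hZh j)]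
  have hq : ∀ j, ∃ q : Poly, q.IsWeightedHomogeneous d n ∧
      bind₁ Z q = if d j ≤ n then Z j * homogeneousComponent (n - d j) (b j) else 0 := by
    intro j
    split_ifs with hjn
    · obtain ⟨q, hq, hq'⟩ := ih (n - d j) (by have := hd j; omega)
        (homogeneousComponent (n - d j) (b j)) (homogeneousComponent_isHomogeneous _ _) fun k => by
          rw [← homogeneousComponent_bind₁ (reflSubst_isHomogeneous (v k)), hbinv]
      refine ⟨X j * q, ?_, by rw [map_mul, bind₁_X_right, hq']⟩
      have := (isWeightedHomogeneous_X ℝ d j).mul hq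
      rwa [Nat.add_sub_cancel' hjn] at this
    · exact ⟨0, isWeightedHomogeneous_zero _ _ _, map_zero _⟩
  choose q hqh hqZ using hq
  refine ⟨C (1 / (c * n)) * ∑ j, C (d j : ℝ) * q j, ?_, ?_⟩
  · have h1 : ∀ (a : ℝ) (p : Poly), p.IsWeightedHomogeneous d n →
        (C a * p).IsWeightedHomogeneous d n := fun a p hp => by
      have := (isWeightedHomogeneous_C d a).mul hp
      rwa [zero_add] at this
    exact h1 _ _ (IsWeightedHomogeneous.sum _ _ _ fun j _ => h1 _ _ (hqh j))
  · simp only [map_mul, map_sum, bind₁_C_right, hqZ]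
    rw [← hcomp, ← mul_assoc, ← C_mul, one_div, inv_mul_cancel₀, C_1, one_mul]
    exact mul_ne_zero hc (Nat.cast_ne_zero.2 hn.ne')

end InvariantRing

/-! ### Gradient pairings in the coordinates h₂, h₆, h₁₀, t -/

/-- The basic invariants of `W(H₃)`, completed by the coordinate `t`. -/
def hq (s : ℝ) : Fin 4 → Poly := ![h2, h6 s, h10 s, X 3]

/-- The basic invariants of `W(H₄)` as polynomials in `h₂, h₆, h₁₀, t`. -/
def ZForm : Fin 4 → Poly :=
  ![X 0 + X 3 ^ 2, Z12Form (X 0) (X 1) (X 2) (X 3), Z20Form (X 0) (X 1) (X 2) (X 3),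
    Z30Form (X 0) (X 1) (X 2) (X 3)]

theorem bind₁_hq_ZForm (s : ℝ) (j : Fin 4) : bind₁ (hq s) (ZForm j) = Z s j := by
  fin_cases j
  · simp [ZForm, Z, hq, Z2]
  · simp [ZForm, Z, hq, Z12, Z12Form, map_ofNat]
  · simp [ZForm, Z, hq, Z20, Z20Form, map_ofNat]
  · simp [ZForm, Z, hq, Z30, Z30Form, map_ofNat]

/-- The pairings of the gradients of `h₂, h₆, h₁₀, t`. -/
def hGram : Matrix (Fin 4) (Fin 4) Poly :=
  !![4 * X 0, 12 * X 1, 20 * X 2, 0;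
    12 * X 1, 8 * X 2 + 8 * X 0 ^ 2 * X 1, 28 * X 0 * X 1 ^ 2 + 8 * X 0 ^ 4 * X 1, 0;
    20 * X 2, 28 * X 0 * X 1 ^ 2 + 8 * X 0 ^ 4 * X 1,
      30 * X 1 ^ 3 + 36 * X 0 ^ 3 * X 1 ^ 2 + 8 * X 0 ^ 4 * X 2, 0;
    0, 0, 0, 1]

theorem pderiv_ofNat (i : Fin 4) (n : ℕ) [n.AtLeastTwo] :
    pderiv i (ofNat(n) : Poly) = 0 := by
  exact (congrArg (pderiv i) (map_ofNat (C : ℝ →+* Poly) n)).symm.trans pderiv_C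

theorem gram_h2_h2 : gram h2 h2 = 4 * h2 := by
  simp only [gram, Fin.sum_univ_four, h2, eps1, map_add, pderiv_pow, pderiv_X, Pi.single_apply]
  simp
  ring

theorem gram_h2_h6 (s : ℝ) : gram h2 (h6 s) = 12 * h6 s := by
  refine MvPolynomial.funext fun x => ?_
  simp [gram, Fin.sum_univ_four, h2, h6, eps1, eps2, eps3, delta, pderiv_X,
    Pi.single_apply, pderiv_ofNat, map_ofNat]
  ring

theorem gram_h2_h10 (s : ℝ) : gram h2 (h10 s) = 20 * h10 s := by
  refine MvPolynomial.funext fun x => ?_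
  simp [gram, Fin.sum_univ_four, h2, h10, eps1, eps2, eps3, delta, pderiv_X,
    Pi.single_apply, pderiv_ofNat, map_ofNat]
  ring

theorem gram_h6_h6 {s : ℝ} (hs : s ^ 2 = 5) : gram (h6 s) (h6 s) = 8 * h10 s + 8 * h2 ^ 2 * h6 s := by
  refine MvPolynomial.funext fun x => ?_
  -- The identity holds modulo `s ^ 2 = 5`; the multiplier collects the coefficient of `s ^ 2`. The
  -- next two pairings are treated in the same way.
  have h := congrArg (fun r => eval x (gram delta delta) * r) hs
  simp [gram, Fin.sum_univ_four, h2, h6, h10, eps1, eps2, eps3, delta, pderiv_X,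
    Pi.single_apply, pderiv_ofNat, map_ofNat,
    -mul_eq_mul_left_iff] at h ⊢
  linear_combination h

theorem gram_h6_h10 {s : ℝ} (hs : s ^ 2 = 5) :
    gram (h6 s) (h10 s) = 28 * h2 * h6 s ^ 2 + 8 * h2 ^ 4 * h6 s := by
  refine MvPolynomial.funext fun x => ?_
  have h := congrArg (fun r => eval x (gram delta (3 * eps2 * delta) - 28 * h2 * delta ^ 2) * r) hs
  simp [gram, Fin.sum_univ_four, h2, h6, h10, eps1, eps2, eps3, delta, pderiv_X,
    Pi.single_apply, pderiv_ofNat, map_ofNat,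
    -mul_eq_mul_left_iff] at h ⊢
  linear_combination h

theorem gram_h10_h10 {s : ℝ} (hs : s ^ 2 = 5) :
    gram (h10 s) (h10 s) = 30 * h6 s ^ 3 + 36 * h2 ^ 3 * h6 s ^ 2 + 8 * h2 ^ 4 * h10 s := by
  refine MvPolynomial.funext fun x => ?_
  have h := congrArg (fun r => eval x (gram (3 * eps2 * delta) (3 * eps2 * delta) -
    90 * (-11 * eps3 + eps1 * eps2) * delta ^ 2 - 30 * C s * delta ^ 3 - 36 * h2 ^ 3 * delta ^ 2) * r) hs
  simp [gram, Fin.sum_univ_four, h2, h6, h10, eps1, eps2, eps3, delta, pderiv_X,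
    Pi.single_apply, pderiv_ofNat, map_ofNat,
    -mul_eq_mul_left_iff] at h ⊢
  linear_combination h

theorem gram_hq_X3 (s : ℝ) (i : Fin 4) : gram (hq s i) (X 3) = if i = 3 then 1 else 0 := by
  have : ∀ F : Poly, gram F (X 3) = pderiv 3 F := by
    intro F
    simp [gram, Fin.sum_univ_four, pderiv_X, Pi.single_apply]
  rw [this]
  fin_cases i <;> simp [hq, h2, h6, h10, eps1, eps2, eps3, delta, pderiv_X,
    Pi.single_apply, pderiv_ofNat]

theorem gram_hq {s : ℝ} (hs : s ^ 2 = 5) (i j : Fin 4) :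
    gram (hq s i) (hq s j) = bind₁ (hq s) (hGram i j) := by
  have h3 := gram_hq_X3 s
  have h3' : ∀ i, gram (X 3) (hq s i) = if i = 3 then 1 else 0 := fun i => gram_comm _ _ |>.trans (h3 i)
  have a0 := h3 0
  have a1 := h3 1
  have a2 := h3 2
  have a3 := h3 3
  have b0 := h3' 0
  have b1 := h3' 1
  have b2 := h3' 2
  simp [hq] at a0 a1 a2 a3 b0 b1 b2
  fin_cases i <;> fin_cases j <;>
    simp [hGram, hq, map_ofNat, gram_h2_h2, gram_h2_h6, gram_h2_h10, gram_h6_h6 hs, gram_h6_h10 hs,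
      gram_h10_h10 hs, gram_comm (h6 s) h2, gram_comm (h10 s) h2, gram_comm (h10 s) (h6 s),
      a0, a1, a2, a3, b0, b1, b2]

/-- The pairing of gradients of polynomials in `h₂, h₆, h₁₀, t`. -/
theorem gram_bind₁_hq {s : ℝ} (hs : s ^ 2 = 5) (F G : Poly) :
    gram (bind₁ (hq s) F) (bind₁ (hq s) G) =
      bind₁ (hq s) (∑ a, ∑ b, pderiv a F * pderiv b G * hGram a b) := by
  simp only [MvPolynomial.gram_bind₁, map_sum, map_mul, ← gram_hq hs]

/-- Working in h₂, h₆, h₁₀, t keeps the expansion feasible. This pairing and the next recover the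
invariants of degrees 20 and 30 from lower ones, so their invariance need not be checked separately.
-/
theorem ZForm_gram_12_12 : ∑ a, ∑ b, pderiv a (ZForm 1) * pderiv b (ZForm 1) * hGram a b =
    44 * ZForm 0 * ZForm 2 - 8 * ZForm 0 ^ 5 * ZForm 1 := by
  refine MvPolynomial.funext fun x => ?_
  simp [Fin.sum_univ_four, ZForm, Z12Form, Z20Form, hGram, pderiv_X,
    Pi.single_apply, pderiv_ofNat, map_ofNat]
  ring

theorem ZForm_gram_12_20 : ∑ a, ∑ b, pderiv a (ZForm 1) * pderiv b (ZForm 2) * hGram a b =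
    -30 * ZForm 3 + 8 * ZForm 0 ^ 3 * ZForm 1 ^ 2 - 24 * ZForm 0 ^ 5 * ZForm 2 := by
  refine MvPolynomial.funext fun x => ?_
  simp [Fin.sum_univ_four, ZForm, Z12Form, Z20Form, Z30Form, hGram, pderiv_X,
    Pi.single_apply, pderiv_ofNat, map_ofNat]
  ring

theorem det_fin_four (A : Matrix (Fin 4) (Fin 4) ℝ) :
    A.det =
      A 0 0 * (A 1 1 * (A 2 2 * A 3 3 - A 2 3 * A 3 2) - A 1 2 * (A 2 1 * A 3 3 - A 2 3 * A 3 1) +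
        A 1 3 * (A 2 1 * A 3 2 - A 2 2 * A 3 1)) -
      A 0 1 * (A 1 0 * (A 2 2 * A 3 3 - A 2 3 * A 3 2) - A 1 2 * (A 2 0 * A 3 3 - A 2 3 * A 3 0) +
        A 1 3 * (A 2 0 * A 3 2 - A 2 2 * A 3 0)) +
      A 0 2 * (A 1 0 * (A 2 1 * A 3 3 - A 2 3 * A 3 1) - A 1 1 * (A 2 0 * A 3 3 - A 2 3 * A 3 0) +
        A 1 3 * (A 2 0 * A 3 1 - A 2 1 * A 3 0)) -
      A 0 3 * (A 1 0 * (A 2 1 * A 3 2 - A 2 2 * A 3 1) - A 1 1 * (A 2 0 * A 3 2 - A 2 2 * A 3 0) +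
        A 1 2 * (A 2 0 * A 3 1 - A 2 1 * A 3 0)) := by
  rw [Matrix.det_succ_row_zero, Fin.sum_univ_four]
  simp only [Matrix.det_fin_three, Matrix.submatrix_apply]
  simp [Fin.succAbove, Fin.lt_def]
  ring

-- The numbers 6, 10, 270, 3 are the values of h₂, h₆, h₁₀, t at (1, 1, 2, 3), the point used to
-- find the constant of J(Z).
set_option maxHeartbeats 1000000 in
theorem eval_pderiv_ZForm {x : Fin 4 → ℝ} (h0 : x 0 = 6) (h1 : x 1 = 10) (h2 : x 2 = 270)
    (h3 : x 3 = 3) (i j : Fin 4) : eval x (pderiv i (ZForm j)) =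
      ![![1, -471690, 4254661200, 572186928830400], ![0, 8049, -81420660, -10130921074800],
        ![0, 93, -1243620, -198098823600], ![6, -1960200, 14661867600, 1933445795774400]] i j := by
  fin_cases j
  · simp only [ZForm]
    fin_cases i <;> simp [pderiv_X, Pi.single_apply, h3]
    norm_num
  · simp only [ZForm]
    fin_cases i <;>
      simp [Z12Form, pderiv_X, Pi.single_apply, pderiv_ofNat,
        map_ofNat, h0, h1, h2, h3] <;> norm_num
  · simp only [ZForm]
    fin_cases i <;>
      simp [Z20Form, pderiv_X, Pi.single_apply, pderiv_ofNat,
        map_ofNat, h0, h1, h2, h3] <;> norm_num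
  · simp only [ZForm]
    fin_cases i <;>
      simp [Z30Form, pderiv_X, Pi.single_apply, pderiv_ofNat,
        map_ofNat, h0, h1, h2, h3] <;> norm_num

theorem eval_det_jacobianMatrix_ZForm {x : Fin 4 → ℝ} (h0 : x 0 = 6) (h1 : x 1 = 10)
    (h2 : x 2 = 270) (h3 : x 3 = 3) :
    eval x (jacobianMatrix ZForm).det = -361152359649607680000000 := by
  rw [RingHom.map_det, det_fin_four]
  simp only [RingHom.mapMatrix_apply, Matrix.map_apply, jacobianMatrix, Matrix.of_apply,
    eval_pderiv_ZForm h0 h1 h2 h3, Matrix.cons_val]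
  norm_num

/-! ### The roots over ℤ[√5]; doubling clears the denominators of a and ā -/

/-- The doubled coefficient vectors of the 60 linear forms, over `ℤ[√5]`, from `p = 2a` and
`q = 2b`. -/
def rootEntries (p q : ℤ√5) : Fin 60 → Fin 4 → ℤ√5 :=
  ![![2, 0, 0, 0], ![0, 2, 0, 0], ![0, 0, 2, 0], ![0, 0, 0, 2],
    ![2, 2, 2, 2], ![2, -2, 2, 2], ![2, 2, -2, 2], ![2, 2, 2, -2],
    ![2, -2, -2, 2], ![2, -2, 2, -2], ![2, 2, -2, -2], ![2, -2, -2, -2],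
    ![2, 0, -p, q], ![2, 0, p, -q], ![2, 0, -p, -q], ![2, 0, p, q],
    ![2, q, 0, -p], ![2, -q, 0, p], ![2, -q, 0, -p], ![2, q, 0, p],
    ![2, -p, q, 0], ![2, p, -q, 0], ![2, -p, -q, 0], ![2, p, q, 0],
    ![q, 2, -p, 0], ![-q, 2, -p, 0], ![-q, 2, p, 0], ![q, 2, p, 0],
    ![-p, 2, 0, q], ![p, 2, 0, -q], ![-p, 2, 0, -q], ![p, 2, 0, q],
    ![0, 2, q, -p], ![0, 2, -q, p], ![0, 2, -q, -p], ![0, 2, q, p],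
    ![-p, q, 2, 0], ![-p, -q, 2, 0], ![p, -q, 2, 0], ![p, q, 2, 0],
    ![0, -p, 2, q], ![0, p, 2, -q], ![0, -p, 2, -q], ![0, p, 2, q],
    ![q, 0, 2, -p], ![-q, 0, 2, -p], ![-q, 0, 2, p], ![q, 0, 2, p],
    ![q, -p, 0, 2], ![-q, -p, 0, 2], ![-q, p, 0, 2], ![q, p, 0, 2],
    ![-p, 0, q, 2], ![-p, 0, -q, 2], ![p, 0, -q, 2], ![p, 0, q, 2],
    ![0, q, -p, 2], ![0, -q, -p, 2], ![0, -q, p, 2], ![0, q, p, 2]]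

/-- The doubled coefficient vectors of the 60 linear forms, over `ℤ[√5]`. -/
def root (k : Fin 60) : Fin 4 → ℤ√5 := rootEntries ⟨1, 1⟩ ⟨1, -1⟩ k

/-- The specialization `√5 ↦ s`. -/
def spec (s : ℝ) (hs : s ^ 2 = 5) : ℤ√5 →+* ℝ :=
  Zsqrtd.lift ⟨s, by rw [← sq, hs]; norm_num⟩

theorem spec_mk {s : ℝ} (hs : s ^ 2 = 5) (m n : ℤ) : spec s hs ⟨m, n⟩ = m + n * s := rfl

/-- As 5 is not a square in ℤ, minors shown nonzero over ℤ[√5] by decision stay nonzero for both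
real square roots of 5. -/
theorem spec_injective {s : ℝ} (hs : s ^ 2 = 5) : Function.Injective (spec s hs) := by
  refine Zsqrtd.lift_injective _ fun n h => ?_
  have h1 : n ≤ 2 := by nlinarith
  have h2 : -2 ≤ n := by nlinarith
  interval_cases n <;> omega

theorem forall_vecCons {α β : Type*} {R : α → β → Prop} {n : ℕ} {x : α} {y : β} {A : Fin n → α}
    {B : Fin n → β} (h : R x y) (hAB : ∀ k, R (A k) (B k)) (k : Fin (n + 1)) :
    R (Matrix.vecCons x A k) (Matrix.vecCons y B k) := by
  cases k using Fin.cases with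
  | zero => exact h
  | succ k => exact hAB k

theorem forall_vecCons_four {α β : Type*} {R : α → β → Prop} {x y z w : α} {x' y' z' w' : β}
    (hx : R x x') (hy : R y y') (hz : R z z') (hw : R w w') (k : Fin 4) :
    R (![x, y, z, w] k) (![x', y', z', w'] k) :=
  forall_vecCons hx (forall_vecCons hy (forall_vecCons hz (forall_vecCons hw fun k => k.elim0))) k

theorem spec_root {s : ℝ} (hs : s ^ 2 = 5) (k : Fin 60) (i : Fin 4) :
    spec s hs (root k i) = 2 * rootCoeff ((1 + s) / 2) ((1 - s) / 2) k i := by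
  have h2 : spec s hs 2 = 2 * 1 := by rw [map_ofNat, mul_one]
  have hp : spec s hs ⟨1, 1⟩ = 2 * ((1 + s) / 2) := by rw [spec_mk]; push_cast; ring
  have hq : spec s hs ⟨1, -1⟩ = 2 * ((1 - s) / 2) := by rw [spec_mk]; push_cast; ring
  rw [root]
  -- With the constants made opaque, every entry is 0, ±2, ±p or ±q, and one of seven hypotheses
  -- matches it.
  generalize (⟨1, 1⟩ : ℤ√5) = p at *
  generalize (⟨1, -1⟩ : ℤ√5) = q at *
  generalize (1 + s) / 2 = a at *
  generalize (1 - s) / 2 = b at *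
  have h2' : spec s hs (-2) = 2 * (-1) := by rw [map_neg, h2]; ring
  have hp' : spec s hs (-p) = 2 * (-a) := by rw [map_neg, hp]; ring
  have hq' : spec s hs (-q) = 2 * (-b) := by rw [map_neg, hq]; ring
  have h0 : spec s hs 0 = 2 * 0 := by rw [map_zero, mul_zero]
  revert i
  revert k
  let R : ℤ√5 → ℝ → Prop := fun x y => spec s hs x = 2 * y
  let S : (Fin 4 → ℤ√5) → (Fin 4 → ℝ) → Prop := fun v w => ∀ i, R (v i) (w i)
  unfold rootEntries rootCoeff
  iterate 60
    refine forall_vecCons (R := S) (forall_vecCons_four (R := R) ?_ ?_ ?_ ?_) ?_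
    iterate 4 (first | exact h0 | exact h2 | exact h2' | exact hp | exact hp' | exact hq | exact hq')
  exact fun k => k.elim0

theorem sum_root_mul_root (k : Fin 60) :
    ∑ l, root k l * root k l = 4 ∨ ∑ l, root k l * root k l = 16 := by
  revert k
  decide +kernel

theorem exists_root_minor_ne (k l : Fin 60) (h : k ≠ l) :
    ∃ i j, root k i * root l j ≠ root k j * root l i := by
  revert k l
  decide +kernel

/-- The product of the doubled forms at (1, 1, 2, 3). It is nonzero, so no mirror passes through
this point, and it has no √5 part. -/
theorem prod_root : ∏ k, (root k 0 + root k 1 + 2 * root k 2 + 3 * root k 3) =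
    ⟨24829224725910528000000 * 2 ^ 60, 0⟩ := by
  decide +kernel

/-! ### Symmetries from sign changes and even permutations -/

/-- The reflection in the hyperplane orthogonal to `v`. -/
def reflect (v x : Fin 4 → ℝ) (i : Fin 4) : ℝ := x i - 2 * v i / (∑ l, v l * v l) * ∑ l, v l * x l

theorem eval_linForm (v x : Fin 4 → ℝ) : eval x (linForm v) = ∑ l, v l * x l := by
  simp [linForm]

theorem eval_bind₁_reflSubst (v x : Fin 4 → ℝ) (F : Poly) :
    eval x (bind₁ (reflSubst v) F) = eval (reflect v x) F := by
  have h : (fun i => eval x (reflSubst v i)) = reflect v x := by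
    ext i
    simp [reflSubst, reflect, eval_linForm]
  rw [eval_bind₁, h]

theorem gram_reflSubst {v : Fin 4 → ℝ} (hv : ∑ l, v l * v l ≠ 0) (i j : Fin 4) :
    gram (reflSubst v i) (reflSubst v j) = if i = j then 1 else 0 := by
  refine MvPolynomial.funext fun x => ?_
  have hp : ∀ m i, eval x (pderiv m (reflSubst v i)) =
      (if i = m then 1 else 0) - 2 * v i / (∑ l, v l * v l) * v m := by
    intro m i
    simp only [reflSubst, map_sub, pderiv_C_mul, pderiv_linForm, pderiv_X, Pi.single_apply, map_mul,
      eval_C]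
    split_ifs <;> simp
  rw [apply_ite (eval x), map_one, map_zero]
  simp only [gram, map_sum, map_mul, hp]
  calc ∑ m, ((if i = m then 1 else 0) - 2 * v i / (∑ l, v l * v l) * v m) *
        ((if j = m then 1 else 0) - 2 * v j / (∑ l, v l * v l) * v m)
      = (∑ m, (if i = m then 1 else 0) * (if j = m then (1 : ℝ) else 0))
          - 2 * v i / (∑ l, v l * v l) * (∑ m, v m * if j = m then 1 else 0)
          - 2 * v j / (∑ l, v l * v l) * (∑ m, v m * if i = m then 1 else 0)
          + 4 * v i * v j / (∑ l, v l * v l) ^ 2 * ∑ m, v m * v m := by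
        rw [Finset.mul_sum, Finset.mul_sum, Finset.mul_sum, ← Finset.sum_sub_distrib,
          ← Finset.sum_sub_distrib, ← Finset.sum_add_distrib]
        exact Finset.sum_congr rfl fun m _ => by ring
    _ = if i = j then 1 else 0 := by
        simp only [mul_ite, mul_one, mul_zero, Finset.sum_ite_eq, Finset.mem_univ, if_true]
        rw [show ∀ a b c d : ℝ, a - b - c + d = a + (d - b - c) from fun _ _ _ _ => by ring]
        rw [show 4 * v i * v j / (∑ l, v l * v l) ^ 2 * ∑ m, v m * v m -
          2 * v i / (∑ l, v l * v l) * v j - 2 * v j / (∑ l, v l * v l) * v i = 0 by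
            field_simp; ring, add_zero]

/-- A pair of maps that preserve the invariants and their conjugates, intertwined by `P`. -/
structure IsSym (g g' : (Fin 4 → ℝ) → Fin 4 → ℝ) : Prop where
  inv : ∀ j x, eval (g x) (Z √5 j) = eval x (Z √5 j)
  inv' : ∀ j x, eval (g' x) (Z (-√5) j) = eval x (Z (-√5) j)
  equivariant : ∀ x, (fun i => eval (g x) (P i)) = g' fun i => eval x (P i)

theorem IsSym.comp {g g' k k' : (Fin 4 → ℝ) → Fin 4 → ℝ} (hg : IsSym g g') (hk : IsSym k k') :
    IsSym (fun x => g (k x)) (fun x => g' (k' x)) where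
  inv j x := (hg.inv j _).trans (hk.inv j x)
  inv' j x := (hg.inv' j _).trans (hk.inv' j x)
  equivariant x := (hg.equivariant _).trans (congrArg g' (hk.equivariant x))

/-- The expression of `h₆` in the coordinates. -/
def h6Fun (s x y z : ℝ) : ℝ :=
  -11 * (x ^ 2 * y ^ 2 * z ^ 2) + (x ^ 2 + y ^ 2 + z ^ 2) * (x ^ 2 * y ^ 2 + x ^ 2 * z ^ 2 + y ^ 2 * z ^ 2)
    + s * ((x ^ 2 - y ^ 2) * (x ^ 2 - z ^ 2) * (y ^ 2 - z ^ 2))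

/-- The expression of `f` in the coordinates. -/
def fFun (x y z t : ℝ) : ℝ :=
  1 / 168 * t * (-21 * h6Fun √5 x y z + 14 * (x ^ 2 + y ^ 2 + z ^ 2) ^ 2 * t ^ 2
    - 14 * (x ^ 2 + y ^ 2 + z ^ 2) * t ^ 4 + 2 * t ^ 6)

theorem eval_h2 (x : Fin 4 → ℝ) : eval x h2 = x 0 ^ 2 + x 1 ^ 2 + x 2 ^ 2 := by
  simp [h2, eps1]

theorem eval_h6 (s : ℝ) (x : Fin 4 → ℝ) : eval x (h6 s) = h6Fun s (x 0) (x 1) (x 2) := by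
  simp [h6, h6Fun, eps1, eps2, eps3, delta]

theorem eval_f (x : Fin 4 → ℝ) : eval x f = fFun (x 0) (x 1) (x 2) (x 3) := by
  simp [f, fFun, eval_h2, eval_h6]

theorem eval_P (x : Fin 4 → ℝ) : (fun i => eval x (P i)) =
    ![fFun (x 3) (x 2) (x 1) (x 0), fFun (x 2) (x 3) (x 0) (x 1), fFun (x 1) (x 0) (x 3) (x 2),
      fFun (x 0) (x 1) (x 2) (x 3)] := by
  ext i
  fin_cases i <;> simp [P, eval_bind₁, eval_f]

theorem eval_Z_congr {s : ℝ} {x y : Fin 4 → ℝ} (ht : y 3 ^ 2 = x 3 ^ 2)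
    (h : ∀ i : Fin 3, eval y (hq s i.castSucc) = eval x (hq s i.castSucc)) (j : Fin 4) :
    eval y (Z s j) = eval x (Z s j) := by
  have e2 : eval y h2 = eval x h2 := h 0
  have e6 : eval y (h6 s) = eval x (h6 s) := h 1
  have e10 : eval y (h10 s) = eval x (h10 s) := h 2
  rcases sq_eq_sq_iff_eq_or_eq_neg.1 ht with h3 | h3
  · fin_cases j <;>
      simp [Z, Z2, Z12, Z12Form, Z20, Z20Form, Z30, Z30Form, e2, e6, e10, h3]
  · fin_cases j <;>
      simp [Z, Z2, Z12, Z12Form, Z20, Z20Form, Z30, Z30Form, e2, e6, e10, h3] <;> ring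

/-- The invariants are even in each coordinate, while `P i` is odd in the i-th coordinate and even
in the others. -/
theorem isSym_sign {e : Fin 4 → ℝ} (he : ∀ i, e i * e i = 1) :
    IsSym (fun x i => e i * x i) (fun x i => e i * x i) := by
  have hsq : ∀ (x : Fin 4 → ℝ) i, (e i * x i) ^ 2 = x i ^ 2 := fun x i => by
    linear_combination x i ^ 2 * he i
  have hZ : ∀ s j (x : Fin 4 → ℝ), eval (fun i => e i * x i) (Z s j) = eval x (Z s j) := by
    intro s j x
    refine eval_Z_congr (hsq x 3) (fun i => ?_) j
    fin_cases i <;> simp [hq, h2, h6, h10, eps1, eps2, eps3, delta, hsq]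
  have hf : ∀ {a b c d x y z t : ℝ}, a ^ 2 = x ^ 2 → b ^ 2 = y ^ 2 → c ^ 2 = z ^ 2 →
      (d * t) ^ 2 = t ^ 2 → fFun a b c (d * t) = d * fFun x y z t := by
    intro a b c d x y z t ha hb hc hd
    have h4 : (d * t) ^ 4 = t ^ 4 := by linear_combination ((d * t) ^ 2 + t ^ 2) * hd
    have h6 : (d * t) ^ 6 = t ^ 6 := by
      linear_combination ((d * t) ^ 4 + (d * t) ^ 2 * t ^ 2 + t ^ 4) * hd
    simp only [fFun, h6Fun, ha, hb, hc, hd, h4, h6]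
    ring
  refine ⟨hZ _, hZ _, fun x => ?_⟩
  rw [eval_P, eval_P]
  ext i
  fin_cases i <;> exact hf (hsq x _) (hsq x _) (hsq x _) (hsq x _)

/-- The cyclic permutation of `u₁, u₂, u₃`. -/
def cyc : Equiv.Perm (Fin 4) := ⟨![1, 2, 0, 3], ![2, 0, 1, 3], by decide, by decide⟩

/-- The double transposition `(12)(34)`. -/
def dbl : Equiv.Perm (Fin 4) := ⟨![1, 0, 3, 2], ![1, 0, 3, 2], by decide, by decide⟩

theorem isSym_cyc : IsSym (fun x i => x (cyc i)) (fun x i => x (cyc i)) := by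
  have hZ : ∀ s j (x : Fin 4 → ℝ), eval (fun i => x (cyc i)) (Z s j) = eval x (Z s j) := by
    intro s j x
    refine eval_Z_congr (x := x) (y := fun i => x (cyc i)) rfl (fun i => ?_) j
    fin_cases i <;> simp [hq, h2, h6, h10, eps1, eps2, eps3, delta, cyc] <;> ring
  refine ⟨hZ _, hZ _, fun x => ?_⟩
  have hf : ∀ x y z t, fFun y z x t = fFun x y z t := fun x y z t => by
    simp only [fFun, h6Fun]
    ring
  rw [eval_P, eval_P]
  ext i
  fin_cases i <;> exact hf _ _ _ _

/-- Pairings of gradients inherit the invariance under orthogonal substitutions. -/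
theorem eval_gram_of_invariant {g : Fin 4 → Poly}
    (hg : ∀ i j, gram (g i) (g j) = if i = j then 1 else 0) {F G : Poly} (hF : bind₁ g F = F)
    (hG : bind₁ g G = G) : bind₁ g (gram F G) = gram F G := by
  rw [← gram_bind₁_of_orthogonal hg, hF, hG]

theorem gram_Z12_Z12 {s : ℝ} (hs : s ^ 2 = 5) :
    gram (Z s 1) (Z s 1) = 44 * Z s 0 * Z s 2 - 8 * Z s 0 ^ 5 * Z s 1 := by
  simp only [← bind₁_hq_ZForm]
  rw [gram_bind₁_hq hs, ZForm_gram_12_12]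
  simp only [map_sub, map_mul, map_pow, map_ofNat]

theorem gram_Z12_Z20 {s : ℝ} (hs : s ^ 2 = 5) :
    gram (Z s 1) (Z s 2) = -30 * Z s 3 + 8 * Z s 0 ^ 3 * Z s 1 ^ 2 - 24 * Z s 0 ^ 5 * Z s 2 := by
  simp only [← bind₁_hq_ZForm]
  rw [gram_bind₁_hq hs, ZForm_gram_12_20]
  simp only [map_sub, map_add, map_neg, map_mul, map_pow, map_ofNat]

/-- An orthogonal substitution that preserves the invariants of degrees 2 and 12 preserves all. -/
theorem bind₁_Z_of_orthogonal {s : ℝ} (hs : s ^ 2 = 5) {g : Fin 4 → Poly}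
    (hg : ∀ i j, gram (g i) (g j) = if i = j then 1 else 0) (h0 : bind₁ g (Z s 0) = Z s 0)
    (h1 : bind₁ g (Z s 1) = Z s 1) (j : Fin 4) : bind₁ g (Z s j) = Z s j := by
  have hne : Z s 0 ≠ 0 := by
    intro h
    have := congrArg (eval ![0, 0, 0, 1]) h
    simp [Z, Z2, eval_h2] at this
  -- Z₂₀ is the only unknown in the formula for the pairing of Z₁₂ with itself; its coefficient 44
  -- Z₂ is cancelled. Z₃₀ follows likewise from the pairing of Z₁₂ with Z₂₀.
  have h2 : bind₁ g (Z s 2) = Z s 2 := by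
    have h := eval_gram_of_invariant hg h1 h1
    rw [gram_Z12_Z12 hs] at h
    simp only [map_sub, map_mul, map_pow, map_ofNat, h0, h1] at h
    have h' := sub_left_inj.1 h
    exact mul_left_cancel₀ (mul_ne_zero (by norm_num) hne) h'
  have h3 : bind₁ g (Z s 3) = Z s 3 := by
    have h := eval_gram_of_invariant hg h1 h2
    rw [gram_Z12_Z20 hs] at h
    simp only [map_sub, map_add, map_neg, map_mul, map_pow, map_ofNat, h0, h1, h2] at h
    have h' := add_right_cancel (sub_left_inj.1 h)
    exact mul_left_cancel₀ (by norm_num) h'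
  fin_cases j
  exacts [h0, h1, h2, h3]

theorem bind₁_dbl_Z {s : ℝ} (hs : s ^ 2 = 5) (j : Fin 4) :
    bind₁ (fun i => X (dbl i)) (Z s j) = Z s j := by
  refine bind₁_Z_of_orthogonal hs (fun i j => ?_) ?_ ?_ j
  · simp [gram, pderiv_X, Pi.single_apply]
  · simp [Z, Z2, h2, eps1, dbl]
    ring
  · refine MvPolynomial.funext fun x => ?_
    rw [eval_bind₁]
    -- This permutation mixes u₄ into the h's, so Z₁₂ has to be expanded. Its only terms in `s ^ 2`
    -- come from (3/2) h₆², which explains the difference of squared `delta`s and the factor 3/2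
    -- below.
    have h := congrArg (fun r => (((x 1 ^ 2 - x 0 ^ 2) * (x 1 ^ 2 - x 3 ^ 2) * (x 0 ^ 2 - x 3 ^ 2)) ^ 2 -
      ((x 0 ^ 2 - x 1 ^ 2) * (x 0 ^ 2 - x 2 ^ 2) * (x 1 ^ 2 - x 2 ^ 2)) ^ 2) * r) hs
    simp [Z, Z12, Z12Form, h2, h6, h10, eps1, eps2, eps3, delta, dbl, -mul_eq_mul_left_iff] at h ⊢
    linear_combination 3 / 2 * h

/-- The `P i` arise from `f` through the Klein four-group of double transpositions, so equivariance
is definitional. -/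
theorem isSym_dbl : IsSym (fun x i => x (dbl i)) (fun x i => x (dbl i)) := by
  have hZ : ∀ {s : ℝ}, s ^ 2 = 5 → ∀ j (x : Fin 4 → ℝ),
      eval (fun i => x (dbl i)) (Z s j) = eval x (Z s j) := by
    intro s hs j x
    conv_rhs => rw [← bind₁_dbl_Z hs, eval_bind₁]
    simp only [eval_X]
  refine ⟨hZ (by norm_num), hZ (by norm_num), fun x => ?_⟩
  rw [eval_P, eval_P]
  ext i
  fin_cases i <;> rfl

/-! ### The one reflection treated by direct computation -/

set_option maxHeartbeats 1000000 in
set_option maxRecDepth 20000 in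
theorem h6Fun_reflect {s : ℝ} (hs : s ^ 2 = 5) (x y z : ℝ) :
    h6Fun s ((2 * x + (1 + s) * y - (1 - s) * z) / 4) (((1 + s) * x + (1 - s) * y - 2 * z) / 4)
      ((-(1 - s) * x - 2 * y + (1 + s) * z) / 4) = h6Fun s x y z := by
  have h3 : s ^ 3 = 5 * s := by rw [pow_succ, hs]
  have h4 : s ^ 4 = 25 := by rw [pow_succ, h3]; linear_combination 5 * hs
  have h5 : s ^ 5 = 25 * s := by rw [pow_succ, h4]
  have h6 : s ^ 6 = 125 := by rw [pow_succ, h5]; linear_combination 25 * hs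
  have h7 : s ^ 7 = 125 * s := by rw [pow_succ, h6]
  simp only [h6Fun]
  ring_nf
  simp only [hs, h3, h4, h5, h6, h7]
  ring


-- The left side is a component of `P` at the point reflected in `root 20`; the right side is that
-- component of the conjugate reflection of `P`. The variable `s` stands for √5 so that its powers
-- can be reduced.
set_option maxHeartbeats 4000000 in
set_option maxRecDepth 20000 in
theorem fFun_reflect_first_coordinate {s : ℝ} (h : √5 = s) (hs : s ^ 2 = 5) (x y z t : ℝ) :
    fFun t ((-(1 - s) * x - 2 * y + (1 + s) * z) / 4) (((1 + s) * x + (1 - s) * y - 2 * z) / 4) ((2 * x + (1 + s) * y - (1 - s) * z) / 4) =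
      (2 * fFun t z y x + (1 - s) * fFun z t x y - (1 + s) * fFun y x t z) / 4 := by
  have h3 : s ^ 3 = 5 * s := by rw [pow_succ, hs]
  have h4 : s ^ 4 = 25 := by rw [pow_succ, h3]; linear_combination 5 * hs
  have h5 : s ^ 5 = 25 * s := by rw [pow_succ, h4]
  have h6 : s ^ 6 = 125 := by rw [pow_succ, h5]; linear_combination 25 * hs
  have h7 : s ^ 7 = 125 * s := by rw [pow_succ, h6]
  have h8 : s ^ 8 = 625 := by rw [pow_succ, h7]; linear_combination 125 * hs
  simp only [fFun, h6Fun, h]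
  ring_nf
  simp only [hs, h3, h4, h5, h6, h7, h8]
  ring

set_option maxHeartbeats 4000000 in
set_option maxRecDepth 20000 in
theorem fFun_reflect_second_coordinate {s : ℝ} (h : √5 = s) (hs : s ^ 2 = 5) (x y z t : ℝ) :
    fFun ((-(1 - s) * x - 2 * y + (1 + s) * z) / 4) t ((2 * x + (1 + s) * y - (1 - s) * z) / 4) (((1 + s) * x + (1 - s) * y - 2 * z) / 4) =
      ((1 - s) * fFun t z y x + (1 + s) * fFun z t x y - 2 * fFun y x t z) / 4 := by
  have h3 : s ^ 3 = 5 * s := by rw [pow_succ, hs]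
  have h4 : s ^ 4 = 25 := by rw [pow_succ, h3]; linear_combination 5 * hs
  have h5 : s ^ 5 = 25 * s := by rw [pow_succ, h4]
  have h6 : s ^ 6 = 125 := by rw [pow_succ, h5]; linear_combination 25 * hs
  have h7 : s ^ 7 = 125 * s := by rw [pow_succ, h6]
  have h8 : s ^ 8 = 625 := by rw [pow_succ, h7]; linear_combination 125 * hs
  simp only [fFun, h6Fun, h]
  ring_nf
  simp only [hs, h3, h4, h5, h6, h7, h8]
  ring

set_option maxHeartbeats 4000000 in
set_option maxRecDepth 20000 in
theorem fFun_reflect_third_coordinate {s : ℝ} (h : √5 = s) (hs : s ^ 2 = 5) (x y z t : ℝ) :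
    fFun (((1 + s) * x + (1 - s) * y - 2 * z) / 4) ((2 * x + (1 + s) * y - (1 - s) * z) / 4) t ((-(1 - s) * x - 2 * y + (1 + s) * z) / 4) =
      (-(1 + s) * fFun t z y x - 2 * fFun z t x y + (1 - s) * fFun y x t z) / 4 := by
  have h3 : s ^ 3 = 5 * s := by rw [pow_succ, hs]
  have h4 : s ^ 4 = 25 := by rw [pow_succ, h3]; linear_combination 5 * hs
  have h5 : s ^ 5 = 25 * s := by rw [pow_succ, h4]
  have h6 : s ^ 6 = 125 := by rw [pow_succ, h5]; linear_combination 25 * hs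
  have h7 : s ^ 7 = 125 * s := by rw [pow_succ, h6]
  have h8 : s ^ 8 = 625 := by rw [pow_succ, h7]; linear_combination 125 * hs
  simp only [fFun, h6Fun, h]
  ring_nf
  simp only [hs, h3, h4, h5, h6, h7, h8]
  ring
theorem sq_sqrt_five : √5 ^ 2 = (5 : ℝ) := Real.sq_sqrt (by norm_num)

theorem sq_neg_sqrt_five : (-√5) ^ 2 = (5 : ℝ) := by rw [neg_sq, sq_sqrt_five]

/-- The value of a vector over `ℤ[√5]` at `√5 ↦ s`. -/
def specVec {s : ℝ} (hs : s ^ 2 = 5) (v : Fin 4 → ℤ√5) (i : Fin 4) : ℝ := spec s hs (v i)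

theorem sum_specVec_mul_specVec {s : ℝ} (hs : s ^ 2 = 5) (v w : Fin 4 → ℤ√5) :
    ∑ l, specVec hs v l * specVec hs w l = spec s hs (∑ l, v l * w l) := by
  simp [specVec]

theorem reflect_specVec_root_20 {s : ℝ} (hs : s ^ 2 = 5) (x : Fin 4 → ℝ) :
    reflect (specVec hs (root 20)) x =
      ![(2 * x 0 + (1 + s) * x 1 - (1 - s) * x 2) / 4, ((1 + s) * x 0 + (1 - s) * x 1 - 2 * x 2) / 4,
        (-(1 - s) * x 0 - 2 * x 1 + (1 + s) * x 2) / 4, x 3] := by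
  have hN : ∑ l, specVec hs (root 20) l * specVec hs (root 20) l = 16 := by
    rw [sum_specVec_mul_specVec, show ∑ l, root 20 l * root 20 l = 16 by decide +kernel, map_ofNat]
  have h0 : specVec hs (root 20) 0 = 2 := map_ofNat (spec s hs) 2
  have h1 : specVec hs (root 20) 1 = -(1 + s) := by
    rw [specVec, show root 20 1 = ⟨-1, -1⟩ by decide +kernel, spec_mk]
    push_cast
    ring
  have h2 : specVec hs (root 20) 2 = 1 - s := by
    rw [specVec, show root 20 2 = ⟨1, -1⟩ by decide +kernel, spec_mk]
    push_cast
    ring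
  have h3 : specVec hs (root 20) 3 = 0 := map_zero _
  have hd : ∀ i, reflect (specVec hs (root 20)) x i = x i - specVec hs (root 20) i / 8 *
      (2 * x 0 - (1 + s) * x 1 + (1 - s) * x 2) := by
    intro i
    rw [reflect, hN, Fin.sum_univ_four, h0, h1, h2, h3]
    ring
  ext i
  rw [hd]
  fin_cases i
  · simp [h0]
    ring
  · simp [h1]
    linear_combination (-x 1 / 8 - x 2 / 8) * hs
  · simp [h2]
    linear_combination (-x 1 / 8 - x 2 / 8) * hs
  · simp [h3]

/-- The pairing of h₆ with itself is 8 h₁₀ + 8 h₂² h₆, so h₁₀ inherits the invariance of h₂ and h₆.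
-/
theorem bind₁_reflSubst_h10 {s : ℝ} (hs : s ^ 2 = 5) {v : Fin 4 → ℝ} (hv : ∑ l, v l * v l ≠ 0)
    (h2 : bind₁ (reflSubst v) h2 = h2) (h6 : bind₁ (reflSubst v) (h6 s) = H4.h6 s) :
    bind₁ (reflSubst v) (h10 s) = h10 s := by
  have h := eval_gram_of_invariant (gram_reflSubst hv) h6 h6
  rw [gram_h6_h6 hs] at h
  simp only [map_add, map_mul, map_pow, map_ofNat, h2, h6] at h
  exact mul_left_cancel₀ (by norm_num) (add_right_cancel h)

theorem eval_Z_reflect_root_20 {s : ℝ} (hs : s ^ 2 = 5) (j : Fin 4) (x : Fin 4 → ℝ) :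
    eval (reflect (specVec hs (root 20)) x) (Z s j) = eval x (Z s j) := by
  have hN : ∑ l, specVec hs (root 20) l * specVec hs (root 20) l ≠ 0 := by
    rw [sum_specVec_mul_specVec, show ∑ l, root 20 l * root 20 l = 16 by decide +kernel, map_ofNat]
    norm_num
  have e2 : bind₁ (reflSubst (specVec hs (root 20))) h2 = h2 := by
    refine MvPolynomial.funext fun x => ?_
    rw [eval_bind₁_reflSubst, reflect_specVec_root_20, eval_h2, eval_h2]
    simp
    linear_combination (x 0 ^ 2 / 8 + x 1 ^ 2 / 8 + x 2 ^ 2 / 8 - x 0 * x 1 / 8 + x 0 * x 2 / 8 +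
      x 1 * x 2 / 8) * hs
  have e6 : bind₁ (reflSubst (specVec hs (root 20))) (h6 s) = h6 s := by
    refine MvPolynomial.funext fun x => ?_
    rw [eval_bind₁_reflSubst, reflect_specVec_root_20, eval_h6, eval_h6]
    exact h6Fun_reflect hs _ _ _
  have e10 := bind₁_reflSubst_h10 hs hN e2 e6
  refine eval_Z_congr (by simp [reflect_specVec_root_20]) (fun i => ?_) j
  rw [← eval_bind₁_reflSubst]
  fin_cases i
  exacts [congrArg _ e2, congrArg _ e6, congrArg _ e10]

/-- The vectors over `ℤ[√5]` whose reflections, together with the conjugate ones, are symmetries. -/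
def IsSymRoot (v : Fin 4 → ℤ√5) : Prop :=
  IsSym (reflect (specVec sq_sqrt_five v)) (reflect (specVec sq_neg_sqrt_five v))

theorem isSymRoot_root_20 : IsSymRoot (root 20) := by
  refine ⟨eval_Z_reflect_root_20 _, eval_Z_reflect_root_20 _, fun x => ?_⟩
  rw [eval_P, eval_P, reflect_specVec_root_20, reflect_specVec_root_20]
  have hh : fFun ((2 * x 0 + (1 + √5) * x 1 - (1 - √5) * x 2) / 4)
      (((1 + √5) * x 0 + (1 - √5) * x 1 - 2 * x 2) / 4)
      ((-(1 - √5) * x 0 - 2 * x 1 + (1 + √5) * x 2) / 4) (x 3) = fFun (x 0) (x 1) (x 2) (x 3) := by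
    have h2 : ((2 * x 0 + (1 + √5) * x 1 - (1 - √5) * x 2) / 4) ^ 2 +
        (((1 + √5) * x 0 + (1 - √5) * x 1 - 2 * x 2) / 4) ^ 2 +
        ((-(1 - √5) * x 0 - 2 * x 1 + (1 + √5) * x 2) / 4) ^ 2 = x 0 ^ 2 + x 1 ^ 2 + x 2 ^ 2 := by
      linear_combination (x 0 ^ 2 / 8 + x 1 ^ 2 / 8 + x 2 ^ 2 / 8 - x 0 * x 1 / 8 + x 0 * x 2 / 8 +
        x 1 * x 2 / 8) * sq_sqrt_five
    rw [fFun, h6Fun_reflect sq_sqrt_five, h2, fFun]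
  have h1 := fFun_reflect_first_coordinate rfl sq_sqrt_five (x 0) (x 1) (x 2) (x 3)
  have h2 := fFun_reflect_second_coordinate rfl sq_sqrt_five (x 0) (x 1) (x 2) (x 3)
  have h3 := fFun_reflect_third_coordinate rfl sq_sqrt_five (x 0) (x 1) (x 2) (x 3)
  ext i
  fin_cases i
  · refine h1.trans ?_
    simp only [sub_neg_eq_add, ← sub_eq_add_neg]
    rfl
  · refine h2.trans ?_
    simp only [sub_neg_eq_add, ← sub_eq_add_neg]
    rfl
  · refine h3.trans ?_
    simp only [sub_neg_eq_add, ← sub_eq_add_neg]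
    rfl
  · exact hh

/-- With these inner products the reflection in `w` sends `v` to `v - w`, so the reflection in `v -
w` is the conjugate of that in `v` by that in `w`. -/
theorem IsSymRoot.reflect_sub {v w : Fin 4 → ℤ√5} (hv : IsSymRoot v) (hw : IsSymRoot w)
    (hww : ∑ l, w l * w l = 16) (hvv : ∑ l, v l * v l = 16) (hwv : ∑ l, w l * v l = 8) :
    IsSymRoot (fun i => v i - w i) := by
  have key : ∀ {s : ℝ} (hs : s ^ 2 = 5) (x : Fin 4 → ℝ), reflect (specVec hs fun i => v i - w i) x =
      reflect (specVec hs w) (reflect (specVec hs v) (reflect (specVec hs w) x)) := by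
    intro s hs x
    have a1 := sum_specVec_mul_specVec hs w w
    have a2 := sum_specVec_mul_specVec hs v v
    have a3 := sum_specVec_mul_specVec hs w v
    rw [hww, map_ofNat] at a1
    rw [hvv, map_ofNat] at a2
    rw [hwv, map_ofNat] at a3
    have hsub : specVec hs (fun i => v i - w i) = fun i => specVec hs v i - specVec hs w i := by
      ext i
      simp [specVec]
    rw [hsub]
    generalize specVec hs v = p at *
    generalize specVec hs w = q at *
    have a4 : ∑ l, (p l - q l) * (p l - q l) = 16 := by
      simp only [Fin.sum_univ_four] at *
      linear_combination a1 + a2 - 2 * a3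
    have b1 : ∑ l, p l * reflect q x l = ∑ l, p l * x l - ∑ l, q l * x l := by
      simp only [reflect, a1]
      simp only [Fin.sum_univ_four] at *
      linear_combination -(q 0 * x 0 + q 1 * x 1 + q 2 * x 2 + q 3 * x 3) / 8 * a3
    have b2 : ∑ l, q l * reflect p (reflect q x) l = -∑ l, p l * x l := by
      simp only [reflect.eq_1 p, a2, b1]
      simp only [reflect, a1]
      simp only [Fin.sum_univ_four] at *
      linear_combination -(q 0 * x 0 + q 1 * x 1 + q 2 * x 2 + q 3 * x 3) / 8 * a1 -
        (p 0 * x 0 + p 1 * x 1 + p 2 * x 2 + p 3 * x 3 -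
          (q 0 * x 0 + q 1 * x 1 + q 2 * x 2 + q 3 * x 3)) / 8 * a3
    ext i
    rw [reflect.eq_1 q (reflect p _), b2, reflect.eq_1 p, b1, reflect.eq_1 q, reflect, a1, a2, a4]
    simp only [sub_mul, Finset.sum_sub_distrib]
    ring
  have h := hw.comp (hv.comp hw)
  unfold IsSymRoot
  rw [funext (key sq_sqrt_five), funext (key sq_neg_sqrt_five)]
  exact h

/-- Symmetries given by signed permutations carry root vectors to root vectors. -/
theorem IsSymRoot.signedPerm {v : Fin 4 → ℤ√5} (hv : IsSymRoot v) {e : Fin 4 → ℤ}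
    (he : ∀ i, e i * e i = 1) {σ : Equiv.Perm (Fin 4)}
    (hσ : IsSym (fun x i => x (σ i)) (fun x i => x (σ i)))
    (hσ' : IsSym (fun x i => x (σ.symm i)) (fun x i => x (σ.symm i))) :
    IsSymRoot (fun i => e i * v (σ i)) := by
  have hR : ∀ i, (e i : ℝ) * e i = 1 := fun i => by exact_mod_cast he i
  have key : ∀ {s : ℝ} (hs : s ^ 2 = 5) (x : Fin 4 → ℝ),
      reflect (specVec hs fun i => e i * v (σ i)) x =
        fun i => (e i : ℝ) * reflect (specVec hs v)
          (fun i => (fun j => (e j : ℝ) * x j) (σ.symm i)) (σ i) := by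
    intro s hs x
    have hsp : ∀ i, specVec hs (fun i => e i * v (σ i)) i = e i * specVec hs v (σ i) := fun i => by
      simp [specVec]
    ext i
    have h1 : ∑ l, specVec hs (fun i => e i * v (σ i)) l * specVec hs (fun i => e i * v (σ i)) l =
        ∑ l, specVec hs v l * specVec hs v l := by
      rw [← Equiv.sum_comp σ fun l => specVec hs v l * specVec hs v l]
      refine Finset.sum_congr rfl fun l _ => ?_
      rw [hsp]
      linear_combination specVec hs v (σ l) * specVec hs v (σ l) * hR l
    have h2 : ∑ l, specVec hs (fun i => e i * v (σ i)) l * x l =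
        ∑ l, specVec hs v l * (e (σ.symm l) * x (σ.symm l)) := by
      rw [← Equiv.sum_comp σ fun l => specVec hs v l * (e (σ.symm l) * x (σ.symm l))]
      refine Finset.sum_congr rfl fun l _ => ?_
      rw [hsp, Equiv.symm_apply_apply]
      ring
    rw [reflect, reflect, h1, h2, hsp]
    simp only [Equiv.symm_apply_apply]
    linear_combination -x i * hR i
  have h := (isSym_sign hR).comp (hσ.comp (hv.comp (hσ'.comp (isSym_sign hR))))
  unfold IsSymRoot
  rw [funext (key sq_sqrt_five), funext (key sq_neg_sqrt_five)]
  exact h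

/-- The even permutations of the coordinates are symmetries. -/
theorem isSym_perm (i j k : ℕ) :
    IsSym (fun x l => x ((cyc ^ i * dbl ^ j * cyc ^ k) l)) (fun x l => x ((cyc ^ i * dbl ^ j * cyc ^ k) l)) := by
  have hmul : ∀ {σ τ : Equiv.Perm (Fin 4)}, IsSym (fun x i => x (σ i)) (fun x i => x (σ i)) →
      IsSym (fun x i => x (τ i)) (fun x i => x (τ i)) →
      IsSym (fun x i => x ((σ * τ) i)) (fun x i => x ((σ * τ) i)) := fun hs ht => ht.comp hs
  have hpow : ∀ {σ : Equiv.Perm (Fin 4)}, IsSym (fun x i => x (σ i)) (fun x i => x (σ i)) →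
      ∀ n : ℕ, IsSym (fun x i => x ((σ ^ n) i)) (fun x i => x ((σ ^ n) i)) := by
    intro σ hs n
    induction n with
    | zero => exact ⟨fun _ _ => rfl, fun _ _ => rfl, fun _ => rfl⟩
    | succ n ih => exact hmul ih hs
  exact hmul (hmul (hpow isSym_cyc i) (hpow isSym_dbl j)) (hpow isSym_cyc k)

/-- The words `cyc ^ i * dbl ^ j * cyc ^ k` exhaust the alternating group, so the inverse of such a
word is again one. -/
theorem isSym_perm_symm (i j k : Fin 3) :
    IsSym (fun x l => x ((cyc ^ (i : ℕ) * dbl ^ (j : ℕ) * cyc ^ (k : ℕ)).symm l))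
      (fun x l => x ((cyc ^ (i : ℕ) * dbl ^ (j : ℕ) * cyc ^ (k : ℕ)).symm l)) := by
  obtain ⟨i', j', k', h⟩ : ∃ i' j' k' : Fin 3,
      (cyc ^ (i : ℕ) * dbl ^ (j : ℕ) * cyc ^ (k : ℕ)).symm =
        cyc ^ (i' : ℕ) * dbl ^ (j' : ℕ) * cyc ^ (k' : ℕ) := by
    revert i j k
    decide +kernel
  rw [h]
  exact isSym_perm _ _ _

/-- The 48 linear forms in three coordinates form one orbit under signed even permutations. -/
theorem root_eq_signedPerm (m : Fin 60) (hm : 12 ≤ m) : ∃ i j k : Fin 3, ∃ e : Fin 4 → Bool,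
    root m = fun l => (((if e l then -1 else 1 : ℤ)) : ℤ√5) *
      root 20 ((cyc ^ (i : ℕ) * dbl ^ (j : ℕ) * cyc ^ (k : ℕ)) l) := by
  revert m
  decide +kernel

/-- Forms in three coordinates are signed even permutations of `root 20`; coordinate forms give sign
changes; each of the eight remaining forms is a difference of two of the former, up to sign, with
inner product 8. -/
theorem isSymRoot_root (k : Fin 60) : IsSymRoot (root k) := by
  have h48 : ∀ m : Fin 60, 12 ≤ m → IsSymRoot (root m) := by
    intro m hm
    obtain ⟨i, j, k, e, h⟩ := root_eq_signedPerm m hm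
    rw [h]
    refine isSymRoot_root_20.signedPerm (e := fun l => if e l then -1 else 1) (fun l => ?_)
      (isSym_perm i j k) (isSym_perm_symm i j k)
    split_ifs <;> norm_num
  have hsgn : ∀ m : Fin 60, 12 ≤ m → ∀ c : Bool,
      IsSymRoot fun i => ((if c then -1 else 1 : ℤ) : ℤ√5) * root m i := by
    intro m hm c
    refine (h48 m hm).signedPerm (e := fun _ => if c then -1 else 1) (fun l => ?_)
      -- Zero exponents give the identity permutation, leaving only the global sign.
      (σ := cyc ^ ((0 : Fin 3) : ℕ) * dbl ^ ((0 : Fin 3) : ℕ) * cyc ^ ((0 : Fin 3) : ℕ))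
      (isSym_perm _ _ _) (isSym_perm_symm _ _ _)
    split_ifs <;> norm_num
  have hcase : (∃ i, root k = Pi.single i 2) ∨ (∃ m n : Fin 60, ∃ c : Bool, 12 ≤ m ∧ 12 ≤ n ∧
      ∑ l, root m l * root m l = 16 ∧ ∑ l, root n l * root n l = 16 ∧
      ∑ l, ((if c then -1 else 1 : ℤ) : ℤ√5) * root n l * root m l = 8 ∧
      root k = fun i => root m i - ((if c then -1 else 1 : ℤ) : ℤ√5) * root n i) ∨ 12 ≤ k := by
    revert k
    decide +kernel
  rcases hcase with ⟨i, hi⟩ | ⟨m, n, c, hm, hn, h1, h2, h3, h⟩ | hk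
  · have hs : ∀ {s : ℝ} (hs : s ^ 2 = 5) (x : Fin 4 → ℝ), reflect (specVec hs (root k)) x =
        fun l => (if l = i then -1 else 1 : ℝ) * x l := by
      intro s hs x
      have hv : ∀ l, specVec hs (root k) l = if l = i then 2 else 0 := by
        intro l
        rw [specVec, hi, Pi.single_apply]
        split_ifs
        · exact map_ofNat _ 2
        · exact map_zero _
      ext l
      simp only [reflect, hv]
      split_ifs with h
      · simp [h]
        ring
      · simp
    unfold IsSymRoot
    rw [funext (hs sq_sqrt_five), funext (hs sq_neg_sqrt_five)]
    exact isSym_sign fun l => by split_ifs <;> norm_num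
  · rw [h]
    refine (h48 m hm).reflect_sub (hsgn n hn c) ?_ h1 h3
    rw [← h2]
    refine Finset.sum_congr rfl fun l _ => ?_
    split_ifs <;> push_cast <;> ring
  · exact h48 k hk

theorem sum_specVec_root_ne_zero {s : ℝ} (hs : s ^ 2 = 5) (k : Fin 60) :
    ∑ l, specVec hs (root k) l * specVec hs (root k) l ≠ 0 := by
  rw [sum_specVec_mul_specVec]
  rcases sum_root_mul_root k with h | h <;> rw [h, map_ofNat] <;> norm_num

theorem exists_specVec_root_minor_ne {s : ℝ} (hs : s ^ 2 = 5) (k l : Fin 60) (h : k ≠ l) :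
    ∃ i j, specVec hs (root k) i * specVec hs (root l) j ≠
      specVec hs (root k) j * specVec hs (root l) i := by
  obtain ⟨i, j, hij⟩ := exists_root_minor_ne k l h
  refine ⟨i, j, fun h0 => hij (spec_injective hs ?_)⟩
  simpa [specVec] using h0

theorem linForm_specVec_root {s : ℝ} (hs : s ^ 2 = 5) (k : Fin 60) :
    linForm (specVec hs (root k)) = C 2 * rootForm s k := by
  simp only [linForm, specVec, spec_root, rootForm, Finset.mul_sum, C_mul, mul_assoc]

theorem prod_linForm_specVec_root {s : ℝ} (hs : s ^ 2 = 5) :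
    ∏ k, linForm (specVec hs (root k)) = C (2 ^ 60) * ∏ k, rootForm s k := by
  simp only [linForm_specVec_root, Finset.prod_mul_distrib, Finset.prod_const, Finset.card_univ,
    Fintype.card_fin, C_pow]

theorem bind₁_reflSubst_Z (k : Fin 60) (j : Fin 4) :
    bind₁ (reflSubst (specVec sq_sqrt_five (root k))) (Z √5 j) = Z √5 j :=
  MvPolynomial.funext fun x => by rw [eval_bind₁_reflSubst, (isSymRoot_root k).inv]

theorem bind₁_reflSubst_Z_conj (k : Fin 60) (j : Fin 4) :
    bind₁ (reflSubst (specVec sq_neg_sqrt_five (root k))) (Z (-√5) j) = Z (-√5) j :=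
  MvPolynomial.funext fun x => by rw [eval_bind₁_reflSubst, (isSymRoot_root k).inv']

theorem bind₁_reflSubst_P (k : Fin 60) (i : Fin 4) :
    bind₁ (reflSubst (specVec sq_sqrt_five (root k))) (P i) =
      bind₁ P (reflSubst (specVec sq_neg_sqrt_five (root k)) i) := by
  refine MvPolynomial.funext fun x => ?_
  rw [eval_bind₁_reflSubst, eval_bind₁]
  have h := congrFun ((isSymRoot_root k).equivariant x) i
  refine h.trans ?_
  simp [reflSubst, reflect, eval_linForm]

/-- Substituting `P` turns a reflection into the conjugate one. -/
theorem bind₁_reflSubst_bind₁_P (k : Fin 60) (F : Poly) :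
    bind₁ (reflSubst (specVec sq_sqrt_five (root k))) (bind₁ P F) =
      bind₁ P (bind₁ (reflSubst (specVec sq_neg_sqrt_five (root k))) F) := by
  rw [bind₁_bind₁, bind₁_bind₁]
  simp only [bind₁_reflSubst_P]

/-! ### The Jacobian of the basic invariants -/

/-- The degrees of the basic invariants. -/
def deg : Fin 4 → ℕ := ![2, 12, 20, 30]

theorem Z_isHomogeneous (s : ℝ) (j : Fin 4) : (Z s j).IsHomogeneous (deg j) := by
  refine isHomogeneous_of_bind₁_two (MvPolynomial.funext fun x => ?_)
  have e2 : eval (fun i => 2 * x i) h2 = 2 ^ 2 * eval x h2 := by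
    simp [h2, eps1]
    ring
  have e6 : eval (fun i => 2 * x i) (h6 s) = 2 ^ 6 * eval x (h6 s) := by
    simp [h6, eps1, eps2, eps3, delta]
    ring
  have e10 : eval (fun i => 2 * x i) (h10 s) = 2 ^ 10 * eval x (h10 s) := by
    simp [h10, eps1, eps2, eps3, delta]
    ring
  rw [eval_bind₁, map_mul, eval_C]
  simp only [map_mul, eval_C, eval_X]
  fin_cases j
  · simp [Z, Z2, e2, deg]
    ring
  · simp [Z, Z12, Z12Form, e2, e6, e10, deg]
    ring
  · simp [Z, Z20, Z20Form, e2, e6, e10, deg]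
    ring
  · simp [Z, Z30, Z30Form, e2, e6, e10, deg]
    ring

theorem P_isHomogeneous (i : Fin 4) : (P i).IsHomogeneous 7 := by
  refine isHomogeneous_of_bind₁_two (MvPolynomial.funext fun x => ?_)
  have hf : ∀ x y z t, fFun (2 * x) (2 * y) (2 * z) (2 * t) = 2 ^ 7 * fFun x y z t := by
    intro x y z t
    simp only [fFun, h6Fun]
    ring
  rw [eval_bind₁, map_mul, eval_C]
  simp only [map_mul, eval_C, eval_X]
  have h1 := congrFun (eval_P fun i => 2 * x i) i
  have h2 := congrFun (eval_P x) i
  refine h1.trans ?_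
  change _ = 2 ^ 7 * (fun i => eval x (P i)) i
  rw [eval_P]
  fin_cases i <;> exact hf _ _ _ _

theorem rootForm_ne_zero {s : ℝ} (hs : s ^ 2 = 5) (k : Fin 60) : rootForm s k ≠ 0 := by
  intro h
  have h1 := linForm_specVec_root hs k
  rw [h, mul_zero] at h1
  exact linForm_ne_zero (fun h0 => sum_specVec_root_ne_zero hs k (by simp [h0])) h1

theorem eval_det_jacobianMatrix_hq (s : ℝ) {x : Fin 4 → ℝ} (h0 : x 0 = 1)
    (h1 : x 1 = 1) (h2 : x 2 = 2) : eval x (jacobianMatrix (hq s)).det = 95040 * s := by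
  rw [RingHom.map_det, det_fin_four]
  simp only [RingHom.mapMatrix_apply, Matrix.map_apply, jacobianMatrix, Matrix.of_apply, hq,
    Matrix.cons_val]
  simp [H4.h2, h6, h10, eps1, eps2, eps3, delta, pderiv_X, Pi.single_apply, pderiv_ofNat, map_ofNat, h0, h1, h2]
  ring

/-- The Jacobian of the basic invariants. -/
theorem det_jacobianMatrix_Z {s : ℝ} (hs : s ^ 2 = 5)
    (hZ : ∀ k j, bind₁ (reflSubst (specVec hs (root k))) (Z s j) = Z s j) :
    (jacobianMatrix (Z s)).det =
      C (-1382400 * s / 2 ^ 60) * ∏ k, linForm (specVec hs (root k)) := by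
  obtain ⟨c, hc⟩ := exists_det_jacobianMatrix_eq (sum_specVec_root_ne_zero hs)
    (exists_specVec_root_minor_ne hs) (Z_isHomogeneous s) hZ (by decide)
  -- The point lies off all mirrors, and u₁ = u₂ there kills `delta`, so h₆ and h₁₀ take the same
  -- values for both signs of `s`.
  have he := congrArg (eval ![1, 1, 2, 3]) hc
  have hJ : (jacobianMatrix (Z s)).det =
      (jacobianMatrix (hq s)).det * bind₁ (hq s) (jacobianMatrix ZForm).det := by
    rw [← det_jacobianMatrix_bind₁]
    simp only [bind₁_hq_ZForm]
  have hp : ∏ k, eval ![1, 1, 2, 3] (linForm (specVec hs (root k))) =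
      24829224725910528000000 * 2 ^ 60 := by
    have h1 : ∀ k, eval ![1, 1, 2, 3] (linForm (specVec hs (root k))) =
        spec s hs (root k 0 + root k 1 + 2 * root k 2 + 3 * root k 3) := by
      intro k
      simp [eval_linForm, Fin.sum_univ_four, specVec, map_ofNat]
      ring
    simp only [h1]
    rw [← map_prod, prod_root, spec_mk]
    norm_num
  rw [hJ, map_mul, eval_det_jacobianMatrix_hq s (by simp) (by simp) (by simp), eval_bind₁,
    eval_det_jacobianMatrix_ZForm, map_mul, eval_C, map_prod, hp] at he
  · rw [hc]
    congr 2
    -- The constant is 95040 · (-361152359649607680000000) / 24829224725910528000000, times `s`: the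
    -- two factors of J(Z) over the product of the forms.
    have : c * 2 ^ 60 = -1382400 * s := by linear_combination -he / 24829224725910528000000
    rw [← this]
    norm_num
  · simp [hq, eval_h2]
    norm_num
  · simp [hq, eval_h6, h6Fun]
    norm_num
  · simp [hq, h10, eps1, eps2, eps3, delta]
    norm_num
  · simp [hq]

theorem det_jacobianMatrix_Z_eq_prod_rootForm {s : ℝ} (hs : s ^ 2 = 5)
    (hZ : ∀ k j, bind₁ (reflSubst (specVec hs (root k))) (Z s j) = Z s j) :
    (jacobianMatrix (Z s)).det = C (-1382400 * s) * ∏ k, rootForm s k := by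
  rw [det_jacobianMatrix_Z hs hZ, prod_linForm_specVec_root, ← mul_assoc, ← C_mul,
    div_mul_cancel₀ _ (by norm_num)]

theorem det_jacobianMatrix_Z_ne_zero : (jacobianMatrix (Z √5)).det ≠ 0 := by
  rw [det_jacobianMatrix_Z_eq_prod_rootForm sq_sqrt_five bind₁_reflSubst_Z]
  refine mul_ne_zero (C_ne_zero.2 (mul_ne_zero (by norm_num) (by positivity))) ?_
  exact Finset.prod_ne_zero_iff.2 fun k _ => rootForm_ne_zero sq_sqrt_five k

/-- The invariants of `W(H₄)` are the polynomials in the basic invariants. -/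
theorem exists_bind₁_Z_eq {n : ℕ} {F : Poly} (hF : F.IsHomogeneous n)
    (hinv : ∀ k, bind₁ (reflSubst (specVec sq_sqrt_five (root k))) F = F) :
    ∃ Q : Poly, Q.IsWeightedHomogeneous deg n ∧ bind₁ (Z √5) Q = F :=
  exists_bind₁_eq_of_invariant (sum_specVec_root_ne_zero sq_sqrt_five)
    (exists_specVec_root_minor_ne sq_sqrt_five) (by decide) (Z_isHomogeneous √5) bind₁_reflSubst_Z
    (div_ne_zero (mul_ne_zero (by norm_num) (by positivity)) (by norm_num))
    (det_jacobianMatrix_Z sq_sqrt_five bind₁_reflSubst_Z) n F hF hinv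

/-! ### Existence and uniqueness of Ŷ and G -/

theorem exists_isExpr : ∃ Yhat, IsExpr Yhat := by
  have h : ∀ j, ∃ Q : Poly, bind₁ (Z √5) Q = Y j := by
    intro j
    obtain ⟨Q, -, hQ⟩ := exists_bind₁_Z_eq (F := Y j)
      ((Z_isHomogeneous (-√5) j).aeval P P_isHomogeneous) fun k => by
        rw [Y, bind₁_reflSubst_bind₁_P, bind₁_reflSubst_Z_conj]
    exact ⟨Q, hQ⟩
  choose Q hQ using h
  exact ⟨Q, hQ⟩

theorem isExpr_unique {F G : Fin 4 → Poly} (hF : IsExpr F) (hG : IsExpr G) : F = G := by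
  ext1 j
  refine sub_eq_zero.1 (eq_zero_of_bind₁_eq_zero det_jacobianMatrix_Z_ne_zero ?_)
  rw [map_sub, hF j, hG j, sub_self]

/-- The form φ* is negated by its own reflection; through `P` this makes φ*(P) negated by the
reflection in φ. -/
theorem exists_isQuot : ∃ G, IsQuot G := by
  have h : ∀ k, ∃ g : Poly, g * rootForm √5 k = bind₁ P (rootForm (-√5) k) := by
    intro k
    have h1 : bind₁ (reflSubst (specVec sq_sqrt_five (root k)))
        (bind₁ P (linForm (specVec sq_neg_sqrt_five (root k)))) =
          -bind₁ P (linForm (specVec sq_neg_sqrt_five (root k))) := by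
      rw [bind₁_reflSubst_bind₁_P,
        bind₁_reflSubst_linForm (sum_specVec_root_ne_zero sq_neg_sqrt_five k), map_neg]
    obtain ⟨q, hq⟩ := linForm_dvd_of_bind₁_eq_neg h1
    rw [linForm_specVec_root, linForm_specVec_root, map_mul, bind₁_C_right, mul_assoc] at hq
    exact ⟨q, by rw [mul_left_cancel₀ (C_ne_zero.2 two_ne_zero) hq, mul_comm]⟩
  choose g hg using h
  exact ⟨g, hg⟩

theorem isQuot_unique {F G : Fin 60 → Poly} (hF : IsQuot F) (hG : IsQuot G) : F = G := by
  ext1 k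
  exact mul_right_cancel₀ (rootForm_ne_zero sq_sqrt_five k) ((hF k).trans (hG k).symm)

theorem IsQuot.isHomogeneous {G : Fin 60 → Poly} (hG : IsQuot G) (k : Fin 60) :
    (G k).IsHomogeneous 6 := by
  have hr : ∀ s, (rootForm s k).IsHomogeneous 1 := fun s => linForm_isHomogeneous _
  refine IsHomogeneous.of_mul_left (hr √5) (rootForm_ne_zero sq_sqrt_five k) (n := 6) ?_
  rw [mul_comm, hG k]
  exact (hr (-√5)).aeval P P_isHomogeneous

/-! ### The Jacobian of P -/

/-- Both sides of the intertwining relation are differentiated; the determinants -1 of the two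
reflections cancel. -/
theorem bind₁_reflSubst_det_jacobianMatrix_P (k : Fin 60) :
    bind₁ (reflSubst (specVec sq_sqrt_five (root k))) (jacobianMatrix P).det =
      (jacobianMatrix P).det := by
  have h1 := det_jacobianMatrix_bind₁ (reflSubst (specVec sq_sqrt_five (root k))) P
  have h2 := det_jacobianMatrix_bind₁ P (reflSubst (specVec sq_neg_sqrt_five (root k)))
  simp only [bind₁_reflSubst_P] at h1
  rw [h1, det_jacobianMatrix_reflSubst (sum_specVec_root_ne_zero _ k),
    det_jacobianMatrix_reflSubst (sum_specVec_root_ne_zero _ k), map_neg, map_one] at h2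
  linear_combination -h2

theorem det_jacobianMatrix_P_isHomogeneous : (jacobianMatrix P).det.IsHomogeneous 24 := by
  rw [Matrix.det_apply']
  refine IsHomogeneous.sum _ _ _ fun p _ => ?_
  have h1 : (∏ i, jacobianMatrix P (p i) i).IsHomogeneous (∑ _i : Fin 4, 6) :=
    IsHomogeneous.prod _ _ _ fun i _ => (P_isHomogeneous i).pderiv
  rw [← map_intCast (C : ℝ →+* Poly)]
  exact h1.C_mul _

/-- Weighted homogeneous polynomials of degree 24 in the basic invariants. -/
theorem exists_bind₁_Z_eq_of_deg_24 {Q : Poly} (hQ : Q.IsWeightedHomogeneous deg 24) :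
    ∃ a b c d : ℝ, bind₁ (Z √5) Q = C a * Z √5 0 ^ 12 + C b * (Z √5 0 ^ 6 * Z √5 1) +
      C c * Z √5 1 ^ 2 + C d * (Z √5 0 ^ 2 * Z √5 2) := by
  rw [Q.as_sum, map_sum]
  refine Finset.sum_induction _ (fun F : Poly => ∃ a b c d : ℝ, F = C a * Z √5 0 ^ 12 +
    C b * (Z √5 0 ^ 6 * Z √5 1) + C c * Z √5 1 ^ 2 + C d * (Z √5 0 ^ 2 * Z √5 2)) ?_ ?_ ?_
  · rintro _ _ ⟨a, b, c, d, rfl⟩ ⟨a', b', c', d', rfl⟩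
    refine ⟨a + a', b + b', c + c', d + d', ?_⟩
    simp only [C_add]
    ring
  · exact ⟨0, 0, 0, 0, by simp⟩
  · intro m hm
    have hw := hQ (mem_support_iff.1 hm)
    rw [Finsupp.weight_apply, Finsupp.sum_fintype _ _ (by simp), Fin.sum_univ_four] at hw
    simp only [deg, smul_eq_mul, Matrix.cons_val] at hw
    have hb : bind₁ (Z √5) (monomial m (coeff m Q)) = C (coeff m Q) *
        (Z √5 0 ^ m 0 * Z √5 1 ^ m 1 * Z √5 2 ^ m 2 * Z √5 3 ^ m 3) := by
      rw [bind₁_monomial]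
      congr 1
      rw [Finset.prod_subset (Finset.subset_univ m.support), Fin.prod_univ_four]
      intro i _ hi
      rw [Finsupp.notMem_support_iff.1 hi, pow_zero]
    have h3 : m 3 = 0 := by omega
    have hcases : (m 0 = 12 ∧ m 1 = 0 ∧ m 2 = 0) ∨ (m 0 = 6 ∧ m 1 = 1 ∧ m 2 = 0) ∨
        (m 0 = 0 ∧ m 1 = 2 ∧ m 2 = 0) ∨ (m 0 = 2 ∧ m 1 = 0 ∧ m 2 = 1) := by
      have b1 : m 1 = 0 ∨ m 1 = 1 ∨ m 1 = 2 := by omega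
      have b2 : m 2 = 0 ∨ m 2 = 1 := by omega
      rcases b1 with b1 | b1 | b1 <;> rcases b2 with b2 | b2 <;> omega
    rw [hb, h3]
    rcases hcases with ⟨e0, e1, e2⟩ | ⟨e0, e1, e2⟩ | ⟨e0, e1, e2⟩ | ⟨e0, e1, e2⟩
    · exact ⟨coeff m Q, 0, 0, 0, by simp [e0, e1, e2]⟩
    · exact ⟨0, coeff m Q, 0, 0, by simp [e0, e1, e2]⟩
    · exact ⟨0, 0, coeff m Q, 0, by simp [e0, e1, e2]⟩
    · exact ⟨0, 0, 0, coeff m Q, by simp [e0, e1, e2]⟩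

/-- On u₁ = u₂ = 0 the polynomial h₆ vanishes together with its gradient. With its counterpart for
u₃ = u₄ = 0, this makes the Jacobian matrix of `P` block diagonal on the plane: two 1×1 blocks and
one 2×2 block. -/
theorem eval_pderiv_f_of_zero_left {x : Fin 4 → ℝ} (h0 : x 0 = 0) (h1 : x 1 = 0) (l : Fin 4) :
    eval x (pderiv l f) = ![0, 0, (56 * x 2 ^ 3 * x 3 ^ 3 - 28 * x 2 * x 3 ^ 5) / 168,
      (42 * x 2 ^ 4 * x 3 ^ 2 - 70 * x 2 ^ 2 * x 3 ^ 4 + 14 * x 3 ^ 6) / 168] l := by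
  fin_cases l <;>
    simp [f, h2, h6, eps1, eps2, eps3, delta, pderiv_X, Pi.single_apply, pderiv_ofNat, map_ofNat, h0, h1] <;> ring

theorem eval_pderiv_f_of_zero_right {x : Fin 4 → ℝ} (h2 : x 2 = 0) (h3 : x 3 = 0) (l : Fin 4) :
    eval x (pderiv l f) = ![0, 0, 0, -((x 0 ^ 2 + x 1 ^ 2) + √5 * (x 0 ^ 2 - x 1 ^ 2)) *
      (x 0 ^ 2 * x 1 ^ 2) / 8] l := by
  fin_cases l <;>
    simp [f, H4.h2, h6, eps1, eps2, eps3, delta, pderiv_X, Pi.single_apply, pderiv_ofNat, map_ofNat, h2, h3]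
  ring

/-- The Jacobian of `P` on the plane `u₁ = u₂ = 0`. -/
theorem eval_det_jacobianMatrix_P (t : ℝ) :
    eval ![0, 0, 1, t] (jacobianMatrix P).det =
      (t ^ 4 * ((1 + t ^ 2) ^ 2 - 5 * (1 - t ^ 2) ^ 2) / 64) *
        ((42 * t ^ 4 - 70 * t ^ 2 + 14) / 168 * ((42 * t ^ 2 - 70 * t ^ 4 + 14 * t ^ 6) / 168) -
          (56 * t ^ 3 - 28 * t) / 168 * ((56 * t ^ 3 - 28 * t ^ 5) / 168)) := by
  have hg : ∀ (g : Fin 4 → Poly) (i : Fin 4), eval ![0, 0, 1, t] (pderiv i (bind₁ g f)) =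
      ∑ l, eval ![0, 0, 1, t] (pderiv i (g l)) *
        eval (fun m => eval ![0, 0, 1, t] (g m)) (pderiv l f) := by
    intro g i
    simp only [pderiv_bind₁, map_sum, map_mul, eval_bind₁]
  have h1 : ∀ i, eval ![0, 0, 1, t] (pderiv i (P 0)) =
      if i = 0 then -((t ^ 2 + 1) + √5 * (t ^ 2 - 1)) * t ^ 2 / 8 else 0 := by
    intro i
    change eval ![0, 0, 1, t] (pderiv i (bind₁ ![X 3, X 2, X 1, X 0] f)) = _
    rw [hg, Fin.sum_univ_four]
    simp only [eval_pderiv_f_of_zero_right (x := fun m =>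
      eval ![0, 0, 1, t] ((![X 3, X 2, X 1, X 0] : Fin 4 → Poly) m)) (by simp) (by simp)]
    fin_cases i <;> simp [pderiv_X, Pi.single_apply]
  have h2 : ∀ i, eval ![0, 0, 1, t] (pderiv i (P 1)) =
      if i = 1 then -((1 + t ^ 2) + √5 * (1 - t ^ 2)) * t ^ 2 / 8 else 0 := by
    intro i
    change eval ![0, 0, 1, t] (pderiv i (bind₁ ![X 2, X 3, X 0, X 1] f)) = _
    rw [hg, Fin.sum_univ_four]
    simp only [eval_pderiv_f_of_zero_right (x := fun m =>
      eval ![0, 0, 1, t] ((![X 2, X 3, X 0, X 1] : Fin 4 → Poly) m)) (by simp) (by simp)]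
    fin_cases i <;> simp [pderiv_X, Pi.single_apply]
  have h3 : ∀ i, eval ![0, 0, 1, t] (pderiv i (P 2)) = ![0, 0,
      (42 * t ^ 4 - 70 * t ^ 2 + 14) / 168, (56 * t ^ 3 - 28 * t) / 168] i := by
    intro i
    change eval ![0, 0, 1, t] (pderiv i (bind₁ ![X 1, X 0, X 3, X 2] f)) = _
    rw [hg, Fin.sum_univ_four]
    simp only [eval_pderiv_f_of_zero_left (x := fun m =>
      eval ![0, 0, 1, t] ((![X 1, X 0, X 3, X 2] : Fin 4 → Poly) m)) (by simp) (by simp)]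
    fin_cases i <;> simp [pderiv_X, Pi.single_apply]
  have h4 : ∀ i, eval ![0, 0, 1, t] (pderiv i (P 3)) = ![0, 0,
      (56 * t ^ 3 - 28 * t ^ 5) / 168, (42 * t ^ 2 - 70 * t ^ 4 + 14 * t ^ 6) / 168] i := by
    intro i
    change eval ![0, 0, 1, t] (pderiv i f) = _
    rw [eval_pderiv_f_of_zero_left (by simp) (by simp)]
    simp
  rw [RingHom.map_det, det_fin_four]
  simp only [RingHom.mapMatrix_apply, Matrix.map_apply, jacobianMatrix, Matrix.of_apply, h1, h2, h3, h4]
  simp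
  -- The two 1×1 blocks are conjugate up to sign changes of √5, and their product involves √5 only
  -- through its square.
  linear_combination -(t ^ 4 * (t ^ 2 - 1) ^ 2 / 64) *
    ((42 * t ^ 4 - 70 * t ^ 2 + 14) / 168 * ((42 * t ^ 2 - 70 * t ^ 4 + 14 * t ^ 6) / 168) -
      (56 * t ^ 3 - 28 * t) / 168 * ((56 * t ^ 3 - 28 * t ^ 5) / 168)) * sq_sqrt_five

/-- The Jacobian of `P` in terms of the basic invariants. -/
theorem det_jacobianMatrix_P :
    (jacobianMatrix P).det = C (-1 / 9216) * (Z2 ^ 2 * Z20 √5 - Z12 √5 ^ 2) := by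
  obtain ⟨Q, hQ, hQP⟩ := exists_bind₁_Z_eq det_jacobianMatrix_P_isHomogeneous
    bind₁_reflSubst_det_jacobianMatrix_P
  obtain ⟨a, b, c, d, h⟩ := exists_bind₁_Z_eq_of_deg_24 hQ
  rw [hQP] at h
  have hz : ∀ t : ℝ, eval ![0, 0, 1, t] (jacobianMatrix P).det =
      a * (1 + t ^ 2) ^ 12 + b * ((1 + t ^ 2) ^ 6 *
        (-2 * t ^ 2 + 6 * t ^ 4 - 14 * t ^ 6 + 6 * t ^ 8 - 2 * t ^ 10)) +
      c * (-2 * t ^ 2 + 6 * t ^ 4 - 14 * t ^ 6 + 6 * t ^ 8 - 2 * t ^ 10) ^ 2 +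
      d * ((1 + t ^ 2) ^ 2 * (4 * t ^ 4 - 20 * t ^ 6 + 44 * t ^ 8 - 44 * t ^ 10 + 44 * t ^ 12 -
        20 * t ^ 14 + 4 * t ^ 16)) := by
    intro t
    have e2 : eval ![0, 0, 1, t] h2 = 1 := by simp [eval_h2]
    have e6 : eval ![0, 0, 1, t] (h6 √5) = 0 := by simp [eval_h6, h6Fun]
    have e10 : eval ![0, 0, 1, t] (h10 √5) = 0 := by simp [h10, eps1, eps2, eps3, delta]
    have z0 : eval ![0, 0, 1, t] (Z √5 0) = 1 + t ^ 2 := by simp [Z, Z2, e2]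
    have z1 : eval ![0, 0, 1, t] (Z √5 1) =
        -2 * t ^ 2 + 6 * t ^ 4 - 14 * t ^ 6 + 6 * t ^ 8 - 2 * t ^ 10 := by
      simp [Z, Z12, Z12Form, e2, e6, e10]
    have z2 : eval ![0, 0, 1, t] (Z √5 2) = 4 * t ^ 4 - 20 * t ^ 6 + 44 * t ^ 8 - 44 * t ^ 10 +
        44 * t ^ 12 - 20 * t ^ 14 + 4 * t ^ 16 := by
      simp [Z, Z20, Z20Form, e2, e6, e10]
      ring
    rw [h]
    simp only [map_add, map_mul, map_pow, eval_C, z0, z1, z2]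
  -- Four values of t give a linear system that determines the four coefficients.
  have e0 := (eval_det_jacobianMatrix_P 0).symm.trans (hz 0)
  have e1 := (eval_det_jacobianMatrix_P 1).symm.trans (hz 1)
  have e2 := (eval_det_jacobianMatrix_P 2).symm.trans (hz 2)
  have e3 := (eval_det_jacobianMatrix_P 3).symm.trans (hz 3)
  norm_num at e0 e1 e2 e3
  have ha : a = 0 := by linarith
  have hb : b = 0 := by linarith
  have hc : c = 1 / 9216 := by linarith
  have hd : d = -1 / 9216 := by linarith
  rw [h, ha, hb, hc, hd, C_0, neg_div, C_neg]
  change 0 * Z2 ^ 12 + 0 * (Z2 ^ 6 * Z12 √5) + _ * Z12 √5 ^ 2 + _ * (Z2 ^ 2 * Z20 √5) = _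
  ring

/-! ### The two factorizations of the Jacobian of Y -/

theorem prod_bind₁_P_rootForm {G : Fin 60 → Poly} (hG : IsQuot G) :
    bind₁ P (∏ k, rootForm (-√5) k) = (∏ k, G k) * ∏ k, rootForm √5 k := by
  rw [map_prod, ← Finset.prod_mul_distrib]
  exact Finset.prod_congr rfl fun k _ => (hG k).symm

theorem bind₁_det_jacobianMatrix_eq {Yhat : Fin 4 → Poly} {G : Fin 60 → Poly} (hY : IsExpr Yhat)
    (hG : IsQuot G) : bind₁ (Z √5) (jacobianMatrix Yhat).det =
      C (1 / (2 ^ 10 * 3 ^ 2)) * (Z2 ^ 2 * Z20 √5 - Z12 √5 ^ 2) * ∏ k, G k := by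
  have h1 := det_jacobianMatrix_bind₁ (Z √5) Yhat
  have h2 := det_jacobianMatrix_bind₁ P (Z (-√5))
  have hY' : (fun j => bind₁ (Z √5) (Yhat j)) = fun j => bind₁ P (Z (-√5) j) := funext hY
  rw [hY', h2] at h1
  rw [det_jacobianMatrix_Z_eq_prod_rootForm sq_neg_sqrt_five bind₁_reflSubst_Z_conj,
    map_mul, bind₁_C_right, prod_bind₁_P_rootForm hG, det_jacobianMatrix_P] at h1
  refine mul_left_cancel₀ det_jacobianMatrix_Z_ne_zero (h1.symm.trans ?_)
  rw [det_jacobianMatrix_Z_eq_prod_rootForm sq_sqrt_five bind₁_reflSubst_Z]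
  -- Conjugation flips the sign of the constant of J(Z), which absorbs the sign of -1/9216; and 9216
  -- = 2¹⁰ · 3².
  have hc : (C (-1 / 9216) * C (-1382400 * -√5) : Poly) =
      C (-1382400 * √5) * C (1 / (2 ^ 10 * 3 ^ 2)) := by
    rw [← C_mul, ← C_mul]
    congr 1
    ring
  linear_combination (Z2 ^ 2 * Z20 √5 - Z12 √5 ^ 2) * (∏ k, G k) * (∏ k, rootForm √5 k) * hc

end H4

end

theorem mainTheorem11 :
    (∃! Yhat : Fin 4 → H4.Poly, H4.IsExpr Yhat) ∧
    (∃! G : Fin 60 → H4.Poly, H4.IsQuot G) ∧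
    ∀ (Yhat : Fin 4 → H4.Poly) (G : Fin 60 → H4.Poly), H4.IsExpr Yhat → H4.IsQuot G →
      (∀ k, (G k).IsHomogeneous 6) ∧
      MvPolynomial.bind₁ (H4.Z √5) (H4.jacobianMatrix Yhat).det =
        MvPolynomial.C (1 / (2 ^ 10 * 3 ^ 2)) *
          (H4.Z2 ^ 2 * H4.Z20 √5 - H4.Z12 √5 ^ 2) * ∏ k, G k := by
  obtain ⟨Yhat, hY⟩ := H4.exists_isExpr
  obtain ⟨G, hG⟩ := H4.exists_isQuot
  exact ⟨⟨Yhat, hY, fun _ h => H4.isExpr_unique h hY⟩, ⟨G, hG, fun _ h => H4.isQuot_unique h hG⟩,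
    fun _ _ h h' => ⟨h'.isHomogeneous, H4.bind₁_det_jacobianMatrix_eq h h'⟩⟩
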